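/- **Proposition.** Let $\gamma\colon[-1,1]\to\mathbb R^3$ be a smooth non-degenerate curve, that is, there is $c_0>0$ with $|\det(\gamma'(s),\gamma''(s),\gamma'''(s))|\ge c_0$ for all $s\in[-1,1]$. Let $(\mathbf e_j(s))_{j=1}^3$ be its Frenet frame, i.e. the orthonormal basis obtained by applying the Gram--Schmidt process to $\gamma'(s),\gamma''(s),\gamma'''(s)$. For $\mathbf r=(r_1,r_2,r_3)\in(0,1)^3$ and $s\in[-1,1]$ define the plate $$\mathcal T_{\mathbf r}(s):=\big\{(y,t)\in\mathbb R^3\times[1,2]: |\langle y-t\gamma(s),\mathbf e_j(s)\rangle|\le r_j \text{ for } j=1,2,3\big\}\subset\mathbb R^4,$$ and for $g\in L^2(\mathbb R^4)=L^2(\mathbb R^3\times\mathbb R)$ (complex valued) and $x\in\mathbb R^3$ define the singular Nikodym maximal function $$\mathcal N_{\mathbf r}^{\mathrm{sing}}g(x):=\sup_{-1\le s\le1}\Big|\frac1{|\mathcal T_{\mathbf r}(s)|}\int_{\mathcal T_{\mathbf r}(s)}g(x-y,t)\,\mathrm dy\,\mathrm dt\Big| .$$ Then there is a constant $C>0$,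 depending only on $\gamma$, such that for every $\mathbf r\in(0,1)^3$ with $$r_3\le r_2\le r_1\le r_2^{1/2}\qquad\text{and}\qquad r_2\le r_1^{1/2}r_3^{1/2},$$ and every $g\in L^2(\mathbb R^4)$, the function $\mathcal N_{\mathbf r}^{\mathrm{sing}}g$ is measurable and $$\|\mathcal N_{\mathbf r}^{\mathrm{sing}}g\|_{L^2(\mathbb R^3)}\le C\,(1+|\log r_3|)^3\,\|g\|_{L^2(\mathbb R^4)} .$$ -/

import Mathlib

open MeasureTheory Set
open scoped ENNReal ContDiff

namespace Nikodym

/-- Euclidean three-space. -/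
abbrev E3 : Type := EuclideanSpace ℝ (Fin 3)

/-- The parameter interval `[-1, 1]`. -/
abbrev I : Set ℝ := Icc (-1) 1

/-- A curve `γ : [-1, 1] → ℝ³` (only the restriction of `γ` to `[-1, 1]` matters) is non-degenerate
if `|det(γ'(s), γ''(s), γ'''(s))|` is bounded below by a positive constant on `[-1, 1]`. -/
def NonDegenerate (γ : ℝ → E3) : Prop :=
  ∃ c₀ : ℝ, 0 < c₀ ∧ ∀ s ∈ I,
    c₀ ≤ |(Matrix.of fun i j : Fin 3 => (iteratedDerivWithin ((j : ℕ) + 1) γ I s) i).det|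

/-- The Frenet frame at `s`: the Gram-Schmidt orthonormalisation of `γ'(s), γ''(s), γ'''(s)`. -/
noncomputable def frenet (γ : ℝ → E3) (s : ℝ) : Fin 3 → E3 :=
  InnerProductSpace.gramSchmidtNormed ℝ fun j : Fin 3 => iteratedDerivWithin ((j : ℕ) + 1) γ I s

/-- The plate of all `(y, t) ∈ ℝ³ × [1, 2]` with `|⟨y - t γ(s), e_j(s)⟩| ≤ r_j` for `j = 1, 2, 3`. -/
def plate (γ : ℝ → E3) (r : Fin 3 → ℝ) (s : ℝ) : Set (E3 × ℝ) :=
  {p | p.2 ∈ Icc (1 : ℝ) 2 ∧ ∀ j, |inner ℝ (p.1 - p.2 • γ s) (frenet γ s j)| ≤ r j}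

/-- The average of `(y, t) ↦ g (x - y, t)` over the plate, with respect to Lebesgue measure. -/
noncomputable def plateAverage (γ : ℝ → E3) (r : Fin 3 → ℝ) (g : E3 × ℝ → ℂ) (x : E3) (s : ℝ) : ℂ :=
  ⨍ p in plate γ r s, g (x - p.1, p.2)

/-- The singular Nikodym maximal function, the supremum over `s ∈ [-1, 1]` of the absolute values
of the plate averages, as a function with values in `[0, ∞]`. -/
noncomputable def nikodymSing (γ : ℝ → E3) (r : Fin 3 → ℝ) (g : E3 × ℝ → ℂ) (x : E3) : ℝ≥0∞ :=
  ⨆ s ∈ I, ‖plateAverage γ r g x s‖ₑ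

end Nikodym

/-! ### Plancherel's theorem for the Fourier integral on L¹ ∩ L². -/

section Plancherel
open FourierTransform SchwartzMap Real

variable {V : Type*} [NormedAddCommGroup V] [InnerProductSpace ℝ V] [FiniteDimensional ℝ V]
  [MeasurableSpace V] [BorelSpace V]

/-! If |s - σ| ≤ r₃, the plate at s lies in a fixed multiple of the ellipsoid with axes r_j
γ^(j)(σ), carried along tγ(σ). Its average is therefore dominated by a Gaussian average A_σ over
that ellipsoid (`Nikodym.FrameBounds.lintegral_plate_le`), and only the parameters of a dyadic grid
with K ≈ 1 + log(1/r₃) generations matter.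

In the space frequency ξ the transform of A_σ is m_σ(ξ) H_ξ(⟨γ(σ), ξ⟩). Here H_ξ is the time
transform of h_ξ(t) = ĝ(ξ, t) cut off to [1, 2], and m_σ(ξ) = exp(-π ∑ r_j² ⟨γ^(j)(σ), ξ⟩²); see
`BoundedSupp.fourier_gaussAverage`. Chaining along the dyadic grid and Plancherel in x reduce the
maximal bound to one claim: in each generation, the squared increments of this symbol sum to
O(‖h_ξ‖₂²), uniformly in ξ, r and the generation (`CurveCoords.sum_norm_sub_sq_le`).

Two facts give the claim. Since h_ξ lives on [1, 2], both H_ξ and its derivative have L² norm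
O(‖h_ξ‖₂), so the increments of H_ξ are controlled by the energy of the arc traversed; by
non-degeneracy s ↦ ⟨γ(s), ξ⟩ runs over each value boundedly often, so the total energy met is
bounded. Moreover s ↦ m_s(ξ) has variation bounded uniformly in ξ and r, by non-degeneracy and r₃ ≤
r₂ ≤ r₁ (`CurveCoords.integral_abs_gaussWeightDeriv_le`), while |H_ξ| ≤ ‖h_ξ‖₂.

The K generations contribute O(1) each, and Cauchy–Schwarz over the chain costs another K + 1, so
the L² operator norm is O(K). -/

theorem continuous_fourier_of_integrable {f : V → ℂ} (h1 : Integrable f) : Continuous (𝓕 f) :=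
  VectorFourier.fourierIntegral_continuous Real.continuous_fourierChar
    (by exact continuous_inner) h1

theorem norm_fourier_le_integral_norm (f : V → ℂ) (ξ : V) : ‖𝓕 f ξ‖ ≤ ∫ x, ‖f x‖ :=
  VectorFourier.norm_fourierIntegral_le_integral_norm _ _ _ _ _

/-- The `L²` Fourier transform of an integrable function is given by the Fourier integral. -/
theorem toLp_fourier_ae_eq_fourier {f : V → ℂ} (h1 : Integrable f) (h2 : MemLp f 2 volume) :
    (𝓕 (h2.toLp f) : Lp (α := V) ℂ 2 volume) =ᵐ[volume] 𝓕 f := by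
  apply ae_eq_of_integral_contDiff_smul_eq
  · exact (Lp.memLp _).locallyIntegrable (by norm_num)
  · exact (continuous_fourier_of_integrable h1).locallyIntegrable (μ := volume)
  -- A test function is Schwartz, so both sides become the integral of f against its transform: for
  -- the L² transform by the distributional definition, for the Fourier integral by the
  -- multiplication formula.
  · intro g g_smooth g_cpt
    have hg₁ : HasCompactSupport (Complex.ofRealCLM ∘ g) := g_cpt.comp_left rfl
    have hg₂ : ContDiff ℝ ∞ (Complex.ofRealCLM ∘ g) := by fun_prop
    set φ : 𝓢(V, ℂ) := hg₁.toSchwartzMap hg₂ with hφ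
    have hφg : ∀ x, φ x = (g x : ℂ) := fun x => by simp [hφ]
    have e1 := congrArg (fun T => T φ) (Lp.fourier_toTemperedDistribution_eq (h2.toLp f))
    simp only [TemperedDistribution.fourier_apply, Lp.toTemperedDistribution_apply] at e1
    have e2 : ∫ x, g x • 𝓕 f x = ∫ x, (𝓕 φ) x • f x := by
      have := VectorFourier.integral_fourierIntegral_smul_eq_flip (μ := volume) (ν := volume)
        (e := Real.fourierChar) (L := innerₗ V) (f := φ) (g := f) Real.continuous_fourierChar
        (by exact continuous_inner) (φ.integrable (μ := volume)) h1
      rw [flip_innerₗ] at this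
      calc ∫ x, g x • 𝓕 f x = ∫ x, φ x • 𝓕 f x := by simp [hφg]
        _ = _ := by
          rw [SchwartzMap.fourier_coe]
          exact this.symm
    rw [e2]
    calc _ = ∫ x, φ x • (𝓕 (h2.toLp f) : Lp (α := V) ℂ 2 volume) x := by simp [hφg]
      _ = _ := e1.symm
      _ = _ := by
        apply integral_congr_ae
        filter_upwards [h2.coeFn_toLp] with x hx
        rw [hx]

theorem eLpNorm_two_sq {α F : Type*} [MeasurableSpace α] [ENorm F] (f : α → F) (μ : Measure α) :
    eLpNorm f 2 μ ^ 2 = ∫⁻ x, ‖f x‖ₑ ^ 2 ∂μ := by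
  have := eLpNorm_nnreal_pow_eq_lintegral (f := f) (μ := μ) (p := 2) two_ne_zero
  simpa only [NNReal.coe_ofNat, ENNReal.coe_ofNat, ENNReal.rpow_ofNat] using this

/-- Plancherel's theorem for the Fourier integral on `L¹ ∩ L²`. -/
theorem lintegral_enorm_fourier_sq {f : V → ℂ} (h1 : Integrable f) (h2 : MemLp f 2 volume) :
    ∫⁻ ξ, ‖𝓕 f ξ‖ₑ ^ 2 = ∫⁻ x, ‖f x‖ₑ ^ 2 := by
  have key : eLpNorm (𝓕 f) 2 volume = eLpNorm f 2 volume := by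
    rw [← eLpNorm_congr_ae (toLp_fourier_ae_eq_fourier h1 h2), ← eLpNorm_congr_ae h2.coeFn_toLp,
      ← Lp.enorm_def, ← Lp.enorm_def, ← ofReal_norm, ← ofReal_norm, Lp.norm_fourier_eq]
  rw [← eLpNorm_two_sq, ← eLpNorm_two_sq, key]

theorem memLp_two_fourier {f : V → ℂ} (h1 : Integrable f) (h2 : MemLp f 2 volume) :
    MemLp (𝓕 f) 2 volume :=
  (memLp_congr_ae (toLp_fourier_ae_eq_fourier h1 h2)).1 (Lp.memLp _)

theorem integral_norm_fourier_sq {f : V → ℂ} (h1 : Integrable f) (h2 : MemLp f 2 volume) :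
    ∫ ξ, ‖𝓕 f ξ‖ ^ 2 = ∫ x, ‖f x‖ ^ 2 := by
  have := lintegral_enorm_fourier_sq h1 h2
  rw [integral_eq_lintegral_of_nonneg_ae (f := fun ξ => ‖𝓕 f ξ‖ ^ 2)
    (.of_forall fun _ => by positivity)
    ((continuous_fourier_of_integrable h1).norm.pow 2).aestronglyMeasurable,
    integral_eq_lintegral_of_nonneg_ae (f := fun x => ‖f x‖ ^ 2)
    (.of_forall fun _ => by positivity) (h1.aestronglyMeasurable.norm.pow 2)]
  simpa only [ENNReal.ofReal_pow (norm_nonneg _), ofReal_norm] using congrArg ENNReal.toReal this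

end Plancherel

/-! ### Energy of the Fourier transform of a function supported in [1, 2]. -/

section BandLimited
open FourierTransform Real

theorem MeasureTheory.MemLp.integrable_sq_norm {α F : Type*} [MeasurableSpace α]
    [NormedAddCommGroup F] {μ : Measure α} {f : α → F} (hf : MemLp f 2 μ) :
    Integrable (fun x => ‖f x‖ ^ 2) μ :=
  (memLp_two_iff_integrable_sq_norm hf.1).1 hf

theorem norm_sub_sq_le_two_mul {F : Type*} [SeminormedAddCommGroup F] (x y : F) :
    ‖x - y‖ ^ 2 ≤ 2 * (‖x‖ ^ 2 + ‖y‖ ^ 2) := by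
  have h := norm_sub_le x y
  nlinarith [norm_nonneg (x - y), norm_nonneg x, norm_nonneg y, sq_nonneg (‖x‖ - ‖y‖)]

/-- The increment of a `C¹` function is bounded in terms of its energy. -/
theorem norm_sub_sq_le_energy_of_short {H H' : ℝ → ℂ} (hd : ∀ u, HasDerivAt H (H' u) u)
    (hc : Continuous H') {a b : ℝ} (hab : a ≤ b) (h1 : b - a ≤ 1) :
    ‖H b - H a‖ ^ 2 ≤ ∫ u in a..b, ‖H' u‖ ^ 2 := by
  have e : ∫ u in a..b, H' u = H b - H a :=
    intervalIntegral.integral_eq_sub_of_hasDerivAt (fun u _ => hd u) (hc.intervalIntegrable _ _)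
  have hn : ‖H b - H a‖ ≤ ∫ u in a..b, ‖H' u‖ := by
    rw [← e]; exact intervalIntegral.norm_integral_le_integral_norm hab
  set m := ∫ u in a..b, ‖H' u‖ with hm
  -- Cauchy–Schwarz by expanding a square: the result is (2 - (b - a)) m² ≤ ∫ ‖H'‖², and b - a ≤ 1.
  have h0 : 0 ≤ ∫ u in a..b, (‖H' u‖ - m) ^ 2 :=
    intervalIntegral.integral_nonneg hab fun _ _ => sq_nonneg _
  have hexp : ∫ u in a..b, (‖H' u‖ - m) ^ 2
      = (∫ u in a..b, ‖H' u‖ ^ 2) - 2 * m * m + (b - a) * m ^ 2 := by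
    have : ∀ u, (‖H' u‖ - m) ^ 2 = (‖H' u‖ ^ 2 - 2 * m * ‖H' u‖) + m ^ 2 := fun u => by ring
    simp_rw [this]
    rw [intervalIntegral.integral_add, intervalIntegral.integral_sub,
      intervalIntegral.integral_const_mul, intervalIntegral.integral_const, smul_eq_mul, ← hm]
    all_goals exact Continuous.intervalIntegrable (by fun_prop) _ _
  have hm2 : m ^ 2 ≤ ∫ u in a..b, ‖H' u‖ ^ 2 := by nlinarith [sq_nonneg m]
  exact (pow_le_pow_left₀ (norm_nonneg _) hn 2).trans hm2

/-- One-dimensional Sobolev embedding: H x differs from H u by at most the energy of the derivative,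
and u is averaged over the unit interval. -/
theorem norm_sq_le_energy_of_unit {H H' : ℝ → ℂ} (hd : ∀ u, HasDerivAt H (H' u) u)
    (hc : Continuous H') {a : ℝ} {x : ℝ} (hx : x ∈ Icc a (a + 1)) :
    ‖H x‖ ^ 2 ≤ 2 * ∫ u in a..(a + 1), (‖H u‖ ^ 2 + ‖H' u‖ ^ 2) := by
  have hH : Continuous H := continuous_iff_continuousAt.2 fun u => (hd u).continuousAt
  have hc2 : Continuous fun u => ‖H' u‖ ^ 2 := by fun_prop
  have hpt : ∀ u ∈ Icc a (a + 1), ‖H x‖ ^ 2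
      ≤ 2 * (‖H u‖ ^ 2 + ∫ u in a..(a + 1), ‖H' u‖ ^ 2) := by
    intro u hu
    have hb : ‖H x - H u‖ ^ 2 ≤ ∫ u in a..(a + 1), ‖H' u‖ ^ 2 := by
      rcases le_total u x with h | h
      · refine (norm_sub_sq_le_energy_of_short hd hc h (by linarith [hx.2, hu.1])).trans ?_
        exact intervalIntegral.integral_mono_interval hu.1 h hx.2
          (.of_forall fun _ => by positivity) (hc2.intervalIntegrable _ _)
      · rw [norm_sub_rev]
        refine (norm_sub_sq_le_energy_of_short hd hc h (by linarith [hu.2, hx.1])).trans ?_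
        exact intervalIntegral.integral_mono_interval hx.1 h hu.2
          (.of_forall fun _ => by positivity) (hc2.intervalIntegrable _ _)
    have h3 : ‖H x‖ ≤ ‖H u‖ + ‖H x - H u‖ := by
      simpa using norm_add_le (H u) (H x - H u)
    nlinarith [norm_nonneg (H x), norm_nonneg (H u), norm_nonneg (H x - H u),
      sq_nonneg (‖H u‖ - ‖H x - H u‖)]
  have := intervalIntegral.integral_mono_on (a := a) (b := a + 1) (by linarith)
    (μ := volume) (f := fun _ => ‖H x‖ ^ 2) (Continuous.intervalIntegrable (by fun_prop) _ _)
    (g := fun u => 2 * (‖H u‖ ^ 2 + ∫ u in a..(a + 1), ‖H' u‖ ^ 2))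
    (Continuous.intervalIntegrable (by fun_prop) _ _) hpt
  rw [intervalIntegral.integral_const_mul, intervalIntegral.integral_add
    (Continuous.intervalIntegrable (by fun_prop) _ _)
    (Continuous.intervalIntegrable (by fun_prop) _ _), intervalIntegral.integral_const,
    intervalIntegral.integral_const] at this
  rw [intervalIntegral.integral_add (Continuous.intervalIntegrable (by fun_prop) _ _)
    (Continuous.intervalIntegrable (by fun_prop) _ _)]
  simpa using this

/-- Cauchy–Schwarz on a long interval would lose its length. There each endpoint value is instead
bounded by the energy of a unit interval inside [a, b], so the constant does not depend on b - a. -/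
theorem norm_sub_sq_le_energy {H H' : ℝ → ℂ} (hd : ∀ u, HasDerivAt H (H' u) u)
    (hc : Continuous H') {a b : ℝ} (hab : a ≤ b) :
    ‖H b - H a‖ ^ 2 ≤ 8 * ∫ u in a..b, (‖H u‖ ^ 2 + ‖H' u‖ ^ 2) := by
  have hH : Continuous H := continuous_iff_continuousAt.2 fun u => (hd u).continuousAt
  have hE : Continuous fun u => ‖H u‖ ^ 2 + ‖H' u‖ ^ 2 := by fun_prop
  have hE0 : 0 ≤ᵐ[volume.restrict (Ioc a b)] fun u => ‖H u‖ ^ 2 + ‖H' u‖ ^ 2 :=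
    .of_forall fun _ => by positivity
  rcases le_total (b - a) 1 with h | h
  · have h1 := norm_sub_sq_le_energy_of_short hd hc hab h
    have h2 : ∫ u in a..b, ‖H' u‖ ^ 2 ≤ ∫ u in a..b, (‖H u‖ ^ 2 + ‖H' u‖ ^ 2) :=
      intervalIntegral.integral_mono_on hab (Continuous.intervalIntegrable (by fun_prop) _ _)
        (hE.intervalIntegrable _ _) fun u _ => by nlinarith [sq_nonneg ‖H u‖]
    have h3 : 0 ≤ ∫ u in a..b, (‖H u‖ ^ 2 + ‖H' u‖ ^ 2) :=
      intervalIntegral.integral_nonneg hab fun _ _ => by positivity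
    linarith
  · have ha := norm_sq_le_energy_of_unit hd hc (a := a) (x := a) ⟨le_rfl, by linarith⟩
    have hb := norm_sq_le_energy_of_unit hd hc (a := b - 1) (x := b) ⟨by linarith, by linarith⟩
    have ha' := intervalIntegral.integral_mono_interval (c := a) (d := b) (a := a) (b := a + 1)
      le_rfl (by linarith) (by linarith) hE0 (hE.intervalIntegrable _ _)
    have hb' := intervalIntegral.integral_mono_interval (c := a) (d := b) (a := b - 1)
      (b := b - 1 + 1) (by linarith) (by linarith) (by linarith) hE0 (hE.intervalIntegrable _ _)
    have := norm_sub_sq_le_two_mul (H b) (H a)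
    linarith

/-- The energy density of the Fourier transform of `h`. -/
noncomputable def fourierEnergy (h : ℝ → ℂ) (u : ℝ) : ℝ :=
  ‖𝓕 h u‖ ^ 2 + ‖𝓕 (fun t : ℝ => (-2 * π * Complex.I * t) • h t) u‖ ^ 2

theorem fourierEnergy_nonneg (h : ℝ → ℂ) (u : ℝ) : 0 ≤ fourierEnergy h u := by
  unfold fourierEnergy; positivity

variable {h : ℝ → ℂ} (h1 : Integrable h) (h2 : MemLp h 2 volume) (hs : ∀ t, t ∉ Icc (1 : ℝ) 2 → h t = 0)
include hs

theorem norm_mul_le_of_band (t : ℝ) :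
    ‖(-2 * π * Complex.I * t : ℂ) • h t‖ ≤ 4 * π * ‖h t‖ := by
  by_cases ht : t ∈ Icc (1 : ℝ) 2
  · rw [norm_smul]
    have : ‖(-2 * π * Complex.I * t : ℂ)‖ = 2 * π * t := by
      simp [abs_of_pos Real.pi_pos, abs_of_nonneg (zero_le_one.trans ht.1)]
    rw [this]
    have := ht.2
    refine mul_le_mul_of_nonneg_right ?_ (norm_nonneg _)
    nlinarith [Real.pi_pos]
  · rw [hs t ht]; simp

include h1

theorem integrable_mul_of_band : Integrable fun t : ℝ => (-2 * π * Complex.I * t : ℂ) • h t := by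
  refine Integrable.mono' (h1.norm.const_mul (4 * π)) ?_ (.of_forall (norm_mul_le_of_band hs))
  exact (Continuous.aestronglyMeasurable (f := fun t : ℝ => (-2 * π * Complex.I * t : ℂ))
    (by fun_prop)).smul h1.aestronglyMeasurable

theorem hasDerivAt_fourier_of_band (u : ℝ) :
    HasDerivAt (𝓕 h) (𝓕 (fun t : ℝ => (-2 * π * Complex.I * t) • h t) u) u := by
  refine Real.hasDerivAt_fourier h1 ?_ u
  refine Integrable.mono' (h1.norm.const_mul 2)
    (continuous_id.aestronglyMeasurable.smul h1.aestronglyMeasurable) (.of_forall fun t => ?_)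
  by_cases ht : t ∈ Icc (1 : ℝ) 2
  · rw [norm_smul, Real.norm_of_nonneg (by linarith [ht.1])]
    exact mul_le_mul_of_nonneg_right ht.2 (norm_nonneg _)
  · simp [hs t ht]

theorem continuous_fourierEnergy : Continuous (fourierEnergy h) :=
  ((continuous_fourier_of_integrable h1).norm.pow 2).add
    ((continuous_fourier_of_integrable (integrable_mul_of_band h1 hs)).norm.pow 2)

theorem norm_fourier_sub_sq_le {a b : ℝ} (hab : a ≤ b) :
    ‖𝓕 h b - 𝓕 h a‖ ^ 2 ≤ 8 * ∫ u in a..b, fourierEnergy h u :=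
  norm_sub_sq_le_energy (hasDerivAt_fourier_of_band h1 hs)
    (continuous_fourier_of_integrable (integrable_mul_of_band h1 hs)) hab

include h2

theorem memLp_mul_of_band : MemLp (fun t : ℝ => (-2 * π * Complex.I * t : ℂ) • h t) 2 volume :=
  MemLp.of_le_mul h2 (integrable_mul_of_band h1 hs).aestronglyMeasurable
    (.of_forall (norm_mul_le_of_band hs))

theorem integrable_fourierEnergy : Integrable (fourierEnergy h) := by
  refine Integrable.add ?_ ?_
  · exact (memLp_two_iff_integrable_sq_norm
      (continuous_fourier_of_integrable h1).aestronglyMeasurable).1 (memLp_two_fourier h1 h2)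
  · exact (memLp_two_iff_integrable_sq_norm (continuous_fourier_of_integrable
      (integrable_mul_of_band h1 hs)).aestronglyMeasurable).1
      (memLp_two_fourier (integrable_mul_of_band h1 hs) (memLp_mul_of_band h1 h2 hs))

/-- Plancherel for h and for -2πit h(t); on the support of h the multiplier has modulus at most 4π.
-/
theorem integral_fourierEnergy_le :
    ∫ u, fourierEnergy h u ≤ (1 + (4 * π) ^ 2) * ∫ t, ‖h t‖ ^ 2 := by
  have i1 := memLp_two_fourier h1 h2
  have i2 := memLp_two_fourier (integrable_mul_of_band h1 hs) (memLp_mul_of_band h1 h2 hs)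
  unfold fourierEnergy
  rw [integral_add i1.integrable_sq_norm i2.integrable_sq_norm,
    integral_norm_fourier_sq h1 h2,
    integral_norm_fourier_sq (integrable_mul_of_band h1 hs) (memLp_mul_of_band h1 h2 hs),
    add_mul, one_mul, ← integral_const_mul]
  refine add_le_add le_rfl (integral_mono (memLp_mul_of_band h1 h2 hs).integrable_sq_norm
    (h2.integrable_sq_norm.const_mul _) fun t => ?_)
  simp only
  rw [← mul_pow]
  exact pow_le_pow_left₀ (norm_nonneg _) (norm_mul_le_of_band hs t) 2

/-- The support has length one, so ‖h‖₁ ≤ ‖h‖₂ by Cauchy–Schwarz, again obtained by expanding a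
square. -/
theorem norm_fourier_sq_le_of_band (u : ℝ) : ‖𝓕 h u‖ ^ 2 ≤ ∫ t, ‖h t‖ ^ 2 := by
  have hn : ‖𝓕 h u‖ ≤ ∫ t, ‖h t‖ := norm_fourier_le_integral_norm h u
  have e : ∀ p : ℕ, p ≠ 0 → ∫ t, ‖h t‖ ^ p = ∫ t in Icc (1 : ℝ) 2, ‖h t‖ ^ p := fun p hp =>
    (setIntegral_eq_integral_of_forall_compl_eq_zero fun t ht => by simp [hs t ht, hp]).symm
  set m := ∫ t, ‖h t‖ with hm
  have e1 : m = ∫ t in Icc (1 : ℝ) 2, ‖h t‖ := by simpa using e 1 one_ne_zero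
  have h0 : 0 ≤ ∫ t in Icc (1 : ℝ) 2, (‖h t‖ - m) ^ 2 := integral_nonneg fun _ => sq_nonneg _
  have hexp : ∫ t in Icc (1 : ℝ) 2, (‖h t‖ - m) ^ 2 = (∫ t, ‖h t‖ ^ 2) - 2 * m * m + m ^ 2 := by
    have : ∀ t, (‖h t‖ - m) ^ 2 = (‖h t‖ ^ 2 - 2 * m * ‖h t‖) + m ^ 2 := fun u => by ring
    simp_rw [this]
    have i1 := h2.integrable_sq_norm.integrableOn (s := Icc (1 : ℝ) 2)
    have i2 := (h1.norm.const_mul (2 * m)).integrableOn (s := Icc (1 : ℝ) 2)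
    have i3 : IntegrableOn (fun t => ‖h t‖ ^ 2 - 2 * m * ‖h t‖) (Icc (1 : ℝ) 2) := i1.sub i2
    rw [integral_add i3 (integrable_const _), integral_sub i1 i2, integral_const_mul,
      ← e1, ← e 2 two_ne_zero, setIntegral_const]
    norm_num
  have hm2 : m ^ 2 ≤ ∫ t, ‖h t‖ ^ 2 := by nlinarith
  exact (pow_le_pow_left₀ (norm_nonneg _) hn 2).trans hm2

end BandLimited

/-! ### Multiplicity of real functions with a derivative of constant sign. -/

section ChangeOfVariables

/-- `f` does not change sign on `s`. -/
def ConstSign (f : ℝ → ℝ) (s : Set ℝ) : Prop := (∀ x ∈ s, 0 ≤ f x) ∨ (∀ x ∈ s, f x ≤ 0)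

theorem ConstSign.mono {f : ℝ → ℝ} {s t : Set ℝ} (h : ConstSign f s) (hts : t ⊆ s) :
    ConstSign f t :=
  h.imp (fun h x hx => h x (hts hx)) (fun h x hx => h x (hts hx))

theorem constSign_of_lower_bound {f : ℝ → ℝ} {a b c : ℝ} (hf : ContinuousOn f (Icc a b))
    (hc : 0 < c) (h : ∀ x ∈ Icc a b, c ≤ |f x|) : ConstSign f (Icc a b) := by
  by_contra hcon
  simp only [ConstSign, not_or, not_forall, not_le] at hcon
  obtain ⟨⟨x, hx, hfx⟩, y, hy, hfy⟩ := hcon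
  obtain ⟨z, hz, hfz⟩ := isPreconnected_Icc.intermediate_value hx hy hf ⟨hfx.le, hfy.le⟩
  have := h z hz
  rw [hfz, abs_zero] at this
  exact absurd this (not_le.2 hc)

theorem MonotoneOn.exists_constSign {f : ℝ → ℝ} {a b : ℝ} (hab : a ≤ b)
    (hf : MonotoneOn f (Icc a b)) (hc : ContinuousOn f (Icc a b)) :
    ∃ c ∈ Icc a b, ConstSign f (Icc a c) ∧ ConstSign f (Icc c b) := by
  have ha : a ∈ Icc a b := left_mem_Icc.2 hab
  have hb : b ∈ Icc a b := right_mem_Icc.2 hab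
  rcases le_total 0 (f a) with h | h
  · exact ⟨a, ha, .inl fun x hx => by rw [le_antisymm hx.2 hx.1]; exact h,
      .inl fun x hx => h.trans (hf ha hx hx.1)⟩
  rcases le_total (f b) 0 with h' | h'
  · exact ⟨b, hb, .inr fun x hx => (hf hx hb hx.2).trans h',
      .inr fun x hx => by rw [le_antisymm hx.2 hx.1]; exact h'⟩
  obtain ⟨c, hc, hfc⟩ := intermediate_value_Icc hab hc ⟨h, h'⟩
  exact ⟨c, hc, .inr fun x hx => hfc ▸ hf ⟨hx.1, hx.2.trans hc.2⟩ hc hx.2,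
    .inl fun x hx => hfc ▸ hf hc ⟨hc.1.trans hx.1, hx.2⟩ hx.1⟩

/-- The function is monotone or antitone, so it changes sign at most once. Each descent by one
derivative thus at most doubles the number of pieces. -/
theorem exists_constSign_of_deriv {f f' : ℝ → ℝ} {a b : ℝ} (hab : a ≤ b)
    (hc : ContinuousOn f (Icc a b)) (hd : ∀ x ∈ Ioo a b, HasDerivAt f (f' x) x)
    (hs : ConstSign f' (Icc a b)) :
    ∃ c ∈ Icc a b, ConstSign f (Icc a c) ∧ ConstSign f (Icc c b) := by
  rcases hs with hs | hs
  · refine MonotoneOn.exists_constSign hab ?_ hc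
    exact monotoneOn_of_hasDerivWithinAt_nonneg (convex_Icc a b) hc
      (fun x hx => (hd x (by simpa using hx)).hasDerivWithinAt)
      (fun x hx => hs x (interior_subset hx))
  · have : MonotoneOn (-f) (Icc a b) := by
      refine monotoneOn_of_hasDerivWithinAt_nonneg (f' := fun x => -f' x) (convex_Icc a b) hc.neg
        (fun x hx => (hd x (by simpa using hx)).neg.hasDerivWithinAt)
        (fun x hx => ?_)
      have := hs x (interior_subset hx)
      linarith
    obtain ⟨c, hc, h1, h2⟩ := MonotoneOn.exists_constSign hab this hc.neg
    refine ⟨c, hc, h1.symm.imp ?_ ?_, h2.symm.imp ?_ ?_⟩ <;>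
    · intro h x hx
      have := h x hx
      simp only [Pi.neg_apply] at this
      linarith

/-- The curve `ψ` with derivative `ψ'` covers almost every point at most `N` times on `[a, b]`,
in the sense of the area formula. -/
def CoversAtMost (N : ℝ) (ψ ψ' : ℝ → ℝ) (a b : ℝ) : Prop :=
  ∀ E : ℝ → ℝ, Continuous E → (∀ u, 0 ≤ E u) → Integrable E →
    ∫ s in a..b, E (ψ s) * |ψ' s| ≤ N * ∫ u, E u

theorem intervalIntegral_le_integral {E : ℝ → ℝ} (h0 : ∀ u, 0 ≤ E u) (hi : Integrable E)
    (a b : ℝ) : ∫ u in a..b, E u ≤ ∫ u, E u := by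
  rcases le_total a b with h | h
  · rw [intervalIntegral.integral_of_le h]
    exact setIntegral_le_integral hi (.of_forall h0)
  · rw [intervalIntegral.integral_of_ge h]
    have h1 : 0 ≤ ∫ u in Ioc b a, E u := integral_nonneg h0
    have h2 : 0 ≤ ∫ u, E u := integral_nonneg h0
    linarith

/-- On a monotone piece the substitution u = ψ(s) gives, up to sign, the integral of E over the
range of ψ. -/
theorem CoversAtMost.of_constSign {ψ ψ' : ℝ → ℝ} {a b : ℝ} (hab : a ≤ b)
    (hc : ContinuousOn ψ (Icc a b)) (hd : ∀ x ∈ Ioo a b, HasDerivAt ψ (ψ' x) x)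
    (hc' : ContinuousOn ψ' (Icc a b)) (hs : ConstSign ψ' (Icc a b)) :
    CoversAtMost 1 ψ ψ' a b := by
  intro E hE hE0 hEi
  have key : ∫ s in a..b, (E ∘ ψ) s * ψ' s = ∫ u in ψ a..ψ b, E u := by
    refine intervalIntegral.integral_comp_mul_deriv''' (by rwa [uIcc_of_le hab])
      (fun x hx => ?_) hE.continuousOn hEi.integrableOn ?_
    · rw [min_eq_left hab, max_eq_right hab] at hx
      exact (hd x hx).hasDerivWithinAt
    · rw [uIcc_of_le hab]
      exact ((hE.comp_continuousOn hc).mul hc').integrableOn_Icc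
  rcases hs with hs | hs
  · calc ∫ s in a..b, E (ψ s) * |ψ' s| = ∫ s in a..b, (E ∘ ψ) s * ψ' s := by
          refine intervalIntegral.integral_congr fun s h => ?_
          rw [uIcc_of_le hab] at h
          simp [abs_of_nonneg (hs s h)]
      _ ≤ 1 * ∫ u, E u := by
          rw [key, one_mul]; exact intervalIntegral_le_integral hE0 hEi _ _
  · calc ∫ s in a..b, E (ψ s) * |ψ' s| = ∫ s in a..b, -((E ∘ ψ) s * ψ' s) := by
          refine intervalIntegral.integral_congr fun s h => ?_
          rw [uIcc_of_le hab] at h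
          simp [abs_of_nonpos (hs s h)]
      _ ≤ 1 * ∫ u, E u := by
          rw [intervalIntegral.integral_neg, key, ← intervalIntegral.integral_symm, one_mul]
          exact intervalIntegral_le_integral hE0 hEi _ _

theorem CoversAtMost.mono {ψ ψ' : ℝ → ℝ} {a b N N' : ℝ} (h : CoversAtMost N ψ ψ' a b)
    (hN : N ≤ N') : CoversAtMost N' ψ ψ' a b := fun E hE hE0 hEi =>
  (h E hE hE0 hEi).trans (mul_le_mul_of_nonneg_right hN (integral_nonneg hE0))

theorem CoversAtMost.append {ψ ψ' : ℝ → ℝ} {a b c N N' : ℝ} (hb : b ∈ Icc a c)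
    (hc : ContinuousOn ψ (Icc a c)) (hc' : ContinuousOn ψ' (Icc a c))
    (h : CoversAtMost N ψ ψ' a b) (h' : CoversAtMost N' ψ ψ' b c) :
    CoversAtMost (N + N') ψ ψ' a c := by
  intro E hE hE0 hEi
  have hcont : ContinuousOn (fun s => E (ψ s) * |ψ' s|) (Icc a c) :=
    (hE.comp_continuousOn hc).mul hc'.abs
  rw [← intervalIntegral.integral_add_adjacent_intervals (b := b), add_mul]
  · exact add_le_add (h E hE hE0 hEi) (h' E hE hE0 hEi)
  · exact (hcont.mono (Icc_subset_Icc_right hb.2)).intervalIntegrable_of_Icc hb.1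
  · exact (hcont.mono (Icc_subset_Icc_left hb.1)).intervalIntegrable_of_Icc hb.2

/-- A curve whose second derivative does not change sign covers each point at most twice. -/
theorem CoversAtMost.of_constSign_two {y₀ y₁ y₂ : ℝ → ℝ} {a b : ℝ} (hab : a ≤ b)
    (h0 : ContinuousOn y₀ (Icc a b)) (h1 : ContinuousOn y₁ (Icc a b))
    (d0 : ∀ x ∈ Ioo a b, HasDerivAt y₀ (y₁ x) x) (d1 : ∀ x ∈ Ioo a b, HasDerivAt y₁ (y₂ x) x)
    (hs : ConstSign y₂ (Icc a b)) : CoversAtMost 2 y₀ y₁ a b := by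
  obtain ⟨c, hc, s1, s2⟩ := exists_constSign_of_deriv hab h1 d1 hs
  have i1 : Icc a c ⊆ Icc a b := Icc_subset_Icc_right hc.2
  have i2 : Icc c b ⊆ Icc a b := Icc_subset_Icc_left hc.1
  refine (CoversAtMost.append (N := 1) (N' := 1) hc h0 h1 ?_ ?_).mono (by norm_num)
  · exact .of_constSign hc.1 (h0.mono i1) (fun x hx => d0 x ⟨hx.1, hx.2.trans_le hc.2⟩)
      (h1.mono i1) s1
  · exact .of_constSign hc.2 (h0.mono i2) (fun x hx => d0 x ⟨hc.1.trans_lt hx.1, hx.2⟩)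
      (h1.mono i2) s2

/-- A curve whose third derivative does not change sign covers each point at most four times. -/
theorem CoversAtMost.of_constSign_three {y₀ y₁ y₂ y₃ : ℝ → ℝ} {a b : ℝ} (hab : a ≤ b)
    (h0 : ContinuousOn y₀ (Icc a b)) (h1 : ContinuousOn y₁ (Icc a b))
    (h2 : ContinuousOn y₂ (Icc a b))
    (d0 : ∀ x ∈ Ioo a b, HasDerivAt y₀ (y₁ x) x) (d1 : ∀ x ∈ Ioo a b, HasDerivAt y₁ (y₂ x) x)
    (d2 : ∀ x ∈ Ioo a b, HasDerivAt y₂ (y₃ x) x)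
    (hs : ConstSign y₃ (Icc a b)) : CoversAtMost 4 y₀ y₁ a b := by
  obtain ⟨c, hc, s1, s2⟩ := exists_constSign_of_deriv hab h2 d2 hs
  have i1 : Icc a c ⊆ Icc a b := Icc_subset_Icc_right hc.2
  have i2 : Icc c b ⊆ Icc a b := Icc_subset_Icc_left hc.1
  refine (CoversAtMost.append (N := 2) (N' := 2) hc h0 h1 ?_ ?_).mono (by norm_num)
  · exact .of_constSign_two hc.1 (h0.mono i1) (h1.mono i1)
      (fun x hx => d0 x ⟨hx.1, hx.2.trans_le hc.2⟩) (fun x hx => d1 x ⟨hx.1, hx.2.trans_le hc.2⟩) s1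
  · exact .of_constSign_two hc.2 (h0.mono i2) (h1.mono i2)
      (fun x hx => d0 x ⟨hc.1.trans_lt hx.1, hx.2⟩) (fun x hx => d1 x ⟨hc.1.trans_lt hx.1, hx.2⟩) s2

end ChangeOfVariables

/-! ### Pairings of a frequency with the curve, and the variation of the Gaussian weight. -/

section CurveCoordinates
open FourierTransform Real

/-- The functions `y 0, …, y 4` behave like the pairings of a vector of length `X > 0` with a
non-degenerate curve and its first four derivatives. -/
structure CurveCoords (B c X : ℝ) (y : ℕ → ℝ → ℝ) : Prop where
  B_pos : 0 < B
  c_pos : 0 < c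
  X_pos : 0 < X
  deriv : ∀ j ≤ 3, ∀ s ∈ Icc (-1 : ℝ) 1, HasDerivWithinAt (y j) (y (j + 1) s) (Icc (-1) 1) s
  cont : ∀ j ≤ 4, ContinuousOn (y j) (Icc (-1) 1)
  bound : ∀ j ≤ 4, ∀ s ∈ Icc (-1 : ℝ) 1, |y j s| ≤ B * X
  lower : ∀ s ∈ Icc (-1 : ℝ) 1, c * X ≤ |y 1 s| ∨ c * X ≤ |y 2 s| ∨ c * X ≤ |y 3 s|

namespace CurveCoords

variable {B c X : ℝ} {y : ℕ → ℝ → ℝ}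

theorem hasDerivAt (hy : CurveCoords B c X y) {a b : ℝ} (hab : Icc a b ⊆ Icc (-1) 1) {j : ℕ}
    (hj : j ≤ 3) {s : ℝ} (hs : s ∈ Ioo a b) : HasDerivAt (y j) (y (j + 1) s) s :=
  (hy.deriv j hj s (hab (Ioo_subset_Icc_self hs))).hasDerivAt
    (Filter.mem_of_superset (Icc_mem_nhds hs.1 hs.2) hab)

theorem abs_sub_le (hy : CurveCoords B c X y) {j : ℕ} (hj : j ≤ 3) {s t : ℝ}
    (hs : s ∈ Icc (-1 : ℝ) 1) (ht : t ∈ Icc (-1 : ℝ) 1) : |y j t - y j s| ≤ B * X * |t - s| :=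
  Convex.norm_image_sub_le_of_norm_hasDerivWithin_le (hy.deriv j hj)
    (fun u hu => hy.bound (j + 1) (by omega) u hu) (convex_Icc _ _) hs ht

/-- On short intervals one of the first three derivatives stays large. -/
theorem exists_lower (hy : CurveCoords B c X y) {a b : ℝ} (hab : a ≤ b)
    (hI : Icc a b ⊆ Icc (-1) 1) (hshort : B * (b - a) ≤ c / 2) :
    (∀ s ∈ Icc a b, c / 2 * X ≤ |y 1 s|) ∨ (∀ s ∈ Icc a b, c / 2 * X ≤ |y 2 s|) ∨
      (∀ s ∈ Icc a b, c / 2 * X ≤ |y 3 s|) := by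
  have key : ∀ j ≤ 3, c * X ≤ |y j a| → ∀ s ∈ Icc a b, c / 2 * X ≤ |y j s| := by
    intro j hj hja s hs
    have h1 := hy.abs_sub_le hj (hI (left_mem_Icc.2 hab)) (hI hs)
    have h2 : B * X * |s - a| ≤ c / 2 * X := by
      rw [abs_of_nonneg (sub_nonneg.2 hs.1)]
      have h3 : B * (s - a) ≤ B * (b - a) :=
        mul_le_mul_of_nonneg_left (sub_le_sub_right hs.2 a) hy.B_pos.le
      calc B * X * (s - a) = B * (s - a) * X := by ring
        _ ≤ c / 2 * X := mul_le_mul_of_nonneg_right (h3.trans hshort) hy.X_pos.le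
    have h4 := abs_sub_abs_le_abs_sub (y j a) (y j s)
    rw [abs_sub_comm] at h4
    linarith
  exact (hy.lower a (hI (left_mem_Icc.2 hab))).imp (key 1 (by norm_num))
    (Or.imp (key 2 (by norm_num)) (key 3 (by norm_num)))

theorem constSign (hy : CurveCoords B c X y) {a b : ℝ} (hI : Icc a b ⊆ Icc (-1) 1) {j : ℕ}
    (hj : j ≤ 4) (h : ∀ s ∈ Icc a b, c / 2 * X ≤ |y j s|) : ConstSign (y j) (Icc a b) :=
  constSign_of_lower_bound ((hy.cont j hj).mono hI)
    (mul_pos (half_pos hy.c_pos) hy.X_pos) h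

theorem coversAtMost_one (hy : CurveCoords B c X y) {a b : ℝ} (hab : a ≤ b)
    (hI : Icc a b ⊆ Icc (-1) 1) {j : ℕ} (hj : j ≤ 3)
    (h : ∀ s ∈ Icc a b, c / 2 * X ≤ |y (j + 1) s|) : CoversAtMost 1 (y j) (y (j + 1)) a b :=
  .of_constSign hab ((hy.cont j (by omega)).mono hI) (fun _ hx => hy.hasDerivAt hI hj hx)
    ((hy.cont (j + 1) (by omega)).mono hI) (hy.constSign hI (by omega) h)

theorem coversAtMost_two (hy : CurveCoords B c X y) {a b : ℝ} (hab : a ≤ b)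
    (hI : Icc a b ⊆ Icc (-1) 1) {j : ℕ} (hj : j ≤ 2)
    (h : ∀ s ∈ Icc a b, c / 2 * X ≤ |y (j + 2) s|) : CoversAtMost 2 (y j) (y (j + 1)) a b :=
  .of_constSign_two hab ((hy.cont j (by omega)).mono hI) ((hy.cont (j + 1) (by omega)).mono hI)
    (fun _ hx => hy.hasDerivAt hI (by omega) hx) (fun _ hx => hy.hasDerivAt hI (by omega) hx)
    (hy.constSign hI (by omega) h)

/-- The worst case is a lower bound on the third derivative only, which leaves up to four monotone
pieces. -/
theorem coversAtMost_four (hy : CurveCoords B c X y) {a b : ℝ} (hab : a ≤ b)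
    (hI : Icc a b ⊆ Icc (-1) 1) (hshort : B * (b - a) ≤ c / 2) :
    CoversAtMost 4 (y 0) (y 1) a b := by
  rcases hy.exists_lower hab hI hshort with h | h | h
  · exact (hy.coversAtMost_one hab hI (j := 0) (by norm_num) h).mono (by norm_num)
  · exact (hy.coversAtMost_two hab hI (j := 0) (by norm_num) h).mono (by norm_num)
  · exact .of_constSign_three hab ((hy.cont 0 (by omega)).mono hI)
      ((hy.cont 1 (by omega)).mono hI) ((hy.cont 2 (by omega)).mono hI)
      (fun _ hx => hy.hasDerivAt hI (by omega) hx) (fun _ hx => hy.hasDerivAt hI (by omega) hx)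
      (fun _ hx => hy.hasDerivAt hI (by omega) hx) (hy.constSign hI (by omega) h)

end CurveCoords

/-- The absolute value of the derivative of `u ↦ exp (-q u ^ 2)`. -/
noncomputable def gaussSlope (q u : ℝ) : ℝ := 2 * q * |u| * exp (-q * u ^ 2)

theorem integrable_gaussSlope {q : ℝ} (hq : 0 < q) : Integrable (gaussSlope q) := by
  have := ((integrable_mul_exp_neg_mul_sq hq).norm).const_mul (2 * q)
  refine this.congr (.of_forall fun u => ?_)
  simp [gaussSlope, mul_assoc]

/-- This is the total variation of exp(-q u²), which rises from 0 to 1 and falls back. That it does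
not depend on q makes the later bounds uniform in the size of the plate. -/
theorem integral_gaussSlope {q : ℝ} (hq : 0 < q) : ∫ u, gaussSlope q u = 2 := by
  have h1 : ∫ u, gaussSlope q u = ∫ u, (fun v => 2 * q * (v * exp (-q * v ^ 2))) |u| := by
    refine integral_congr_ae (.of_forall fun u => ?_)
    simp [gaussSlope, mul_assoc]
  have h2 : ∫ r in Ioi (0 : ℝ), r * exp (-q * r ^ 2) = (2 * q)⁻¹ := by
    have := integral_mul_cexp_neg_mul_sq (b := (q : ℂ)) (by simpa using hq)
    rw [← Complex.ofReal_inj, ← integral_complex_ofReal]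
    push_cast
    simpa using this
  rw [h1, integral_comp_abs (f := fun v => 2 * q * (v * exp (-q * v ^ 2))), integral_const_mul, h2]
  field_simp

theorem continuous_gaussSlope (q : ℝ) : Continuous (gaussSlope q) := by
  unfold gaussSlope; fun_prop

theorem gaussSlope_nonneg {q : ℝ} (hq : 0 < q) (u : ℝ) : 0 ≤ gaussSlope q u := by
  unfold gaussSlope; positivity

theorem mul_exp_neg_le_one (u : ℝ) : u * exp (-u) ≤ 1 := by
  have h := add_one_le_exp u
  have h2 := exp_pos (-u)
  have h3 : exp u * exp (-u) = 1 := by rw [← exp_add]; simp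
  nlinarith

/-- The Gaussian weight of a point with coordinates `y 1, y 2, y 3`. -/
noncomputable def gaussWeight (q₁ q₂ q₃ : ℝ) (y : ℕ → ℝ → ℝ) (s : ℝ) : ℝ :=
  exp (-(q₁ * y 1 s ^ 2 + q₂ * y 2 s ^ 2 + q₃ * y 3 s ^ 2))

/-- The derivative of the Gaussian weight along the curve. -/
noncomputable def gaussWeightDeriv (q₁ q₂ q₃ : ℝ) (y : ℕ → ℝ → ℝ) (s : ℝ) : ℝ :=
  gaussWeight q₁ q₂ q₃ y s *
    -(2 * q₁ * (y 1 s * y 2 s) + 2 * q₂ * (y 2 s * y 3 s) + 2 * q₃ * (y 3 s * y 4 s))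

namespace CurveCoords

variable {B c X : ℝ} {y : ℕ → ℝ → ℝ} {q₁ q₂ q₃ : ℝ}

theorem continuousOn_gaussWeight (hy : CurveCoords B c X y) :
    ContinuousOn (gaussWeight q₁ q₂ q₃ y) (Icc (-1) 1) := by
  have c1 := hy.cont 1 (by norm_num)
  have c2 := hy.cont 2 (by norm_num)
  have c3 := hy.cont 3 (by norm_num)
  unfold gaussWeight
  fun_prop

theorem continuousOn_gaussWeightDeriv (hy : CurveCoords B c X y) :
    ContinuousOn (gaussWeightDeriv q₁ q₂ q₃ y) (Icc (-1) 1) := by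
  have c0 := hy.continuousOn_gaussWeight (q₁ := q₁) (q₂ := q₂) (q₃ := q₃)
  have c1 := hy.cont 1 (by norm_num)
  have c2 := hy.cont 2 (by norm_num)
  have c3 := hy.cont 3 (by norm_num)
  have c4 := hy.cont 4 (by norm_num)
  unfold gaussWeightDeriv
  fun_prop

theorem hasDerivAt_gaussWeight (hy : CurveCoords B c X y) {a b : ℝ}
    (hab : Icc a b ⊆ Icc (-1) 1) {s : ℝ} (hs : s ∈ Ioo a b) :
    HasDerivAt (gaussWeight q₁ q₂ q₃ y) (gaussWeightDeriv q₁ q₂ q₃ y s) s := by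
  have d1 := (((hy.hasDerivAt hab (j := 1) (by norm_num) hs).pow 2).const_mul q₁)
  have d2 := (((hy.hasDerivAt hab (j := 2) (by norm_num) hs).pow 2).const_mul q₂)
  have d3 := (((hy.hasDerivAt hab (j := 3) (by norm_num) hs).pow 2).const_mul q₃)
  have := ((d1.add d2).add d3).neg.exp
  refine this.congr_deriv ?_
  simp only [gaussWeightDeriv, gaussWeight, Pi.add_apply, Pi.neg_apply, Pi.pow_apply]
  push_cast
  ring

/-- With u = q (cX/2)², a large coordinate whose exponent is at least q forces the weight below
exp(-u), while the product of coordinates is at most a constant times u; then u exp(-u) ≤ 1. -/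
theorem gaussWeight_mul_le (hy : CurveCoords B c X y) (h1 : 0 ≤ q₁) (h2 : 0 ≤ q₂) (h3 : 0 ≤ q₃)
    {q : ℝ} (hq : 0 ≤ q) {s : ℝ} {i j : ℕ} (hi : i ≤ 4) (hj : j ≤ 4) (hs : s ∈ Icc (-1 : ℝ) 1)
    (hlow : (q ≤ q₁ ∧ c / 2 * X ≤ |y 1 s|) ∨ (q ≤ q₂ ∧ c / 2 * X ≤ |y 2 s|) ∨
      (q ≤ q₃ ∧ c / 2 * X ≤ |y 3 s|)) :
    gaussWeight q₁ q₂ q₃ y s * (2 * q * (|y i s| * |y j s|)) ≤ 8 * (B / c) ^ 2 := by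
  have hc := hy.c_pos
  have hX := hy.X_pos
  have hB := hy.B_pos
  set u := q * (c / 2 * X) ^ 2 with hu
  have hexp : gaussWeight q₁ q₂ q₃ y s ≤ exp (-u) := by
    unfold gaussWeight
    refine exp_le_exp.2 (neg_le_neg ?_)
    have g : ∀ {p z : ℝ}, q ≤ p ∧ c / 2 * X ≤ |z| → u ≤ p * z ^ 2 := by
      intro p z hz
      rw [← sq_abs z]
      exact mul_le_mul hz.1 (pow_le_pow_left₀ (by positivity) hz.2 2) (by positivity)
        (hq.trans hz.1)
    have n1 := mul_nonneg h1 (sq_nonneg (y 1 s))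
    have n2 := mul_nonneg h2 (sq_nonneg (y 2 s))
    have n3 := mul_nonneg h3 (sq_nonneg (y 3 s))
    rcases hlow with h | h | h <;> have := g h <;> linarith
  have hprod : 2 * q * (|y i s| * |y j s|) ≤ 8 * (B / c) ^ 2 * u := by
    have e : 8 * (B / c) ^ 2 * u = 2 * q * ((B * X) * (B * X)) := by
      rw [hu]; field_simp; ring
    rw [e]
    have := mul_le_mul (hy.bound i hi s hs) (hy.bound j hj s hs) (abs_nonneg _) (by positivity)
    exact mul_le_mul_of_nonneg_left this (by positivity)
  calc gaussWeight q₁ q₂ q₃ y s * (2 * q * (|y i s| * |y j s|))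
      ≤ exp (-u) * (8 * (B / c) ^ 2 * u) :=
        mul_le_mul hexp hprod (by positivity) (exp_pos _).le
    _ = 8 * (B / c) ^ 2 * (u * exp (-u)) := by ring
    _ ≤ 8 * (B / c) ^ 2 * 1 := mul_le_mul_of_nonneg_left (mul_exp_neg_le_one u) (by positivity)
    _ = _ := mul_one _

theorem integral_le_of_coversAtMost (hy : CurveCoords B c X y) {a b N q : ℝ} (hab : a ≤ b)
    (hI : Icc a b ⊆ Icc (-1) 1) {j : ℕ} (hj : j ≤ 3) (hq : 0 < q)
    (hN : N ≤ 2) (hcov : CoversAtMost N (y j) (y (j + 1)) a b) {f : ℝ → ℝ} (hf : ContinuousOn f (Icc a b))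
    (hle : ∀ s ∈ Icc a b, f s ≤ gaussSlope q (y j s) * |y (j + 1) s|) :
    ∫ s in a..b, f s ≤ 4 := by
  have h := hcov (gaussSlope q) (continuous_gaussSlope q) (gaussSlope_nonneg hq)
    (integrable_gaussSlope hq)
  rw [integral_gaussSlope hq] at h
  have c1 : ContinuousOn (fun s => gaussSlope q (y j s) * |y (j + 1) s|) (Icc a b) :=
    ((continuous_gaussSlope q).comp_continuousOn ((hy.cont j (by omega)).mono hI)).mul
      ((hy.cont (j + 1) (by omega)).mono hI).abs
  have := intervalIntegral.integral_mono_on (μ := volume) hab (hf.intervalIntegrable_of_Icc hab)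
    (c1.intervalIntegrable_of_Icc hab) hle
  linarith

/-- The derivative has three terms, q₁ y₁ y₂, q₂ y₂ y₃ and q₃ y₃ y₄, each times the weight, and on a
short interval some y_i with i ≤ 3 stays comparable to X. For the term with q_j there are two cases.
If i ≤ j, then q_i ≥ q_j and the term is bounded pointwise. If i > j, then y_j has at most two
monotone pieces, and the term integrates to at most the variation of exp(-q_j y_j²). -/
theorem integral_abs_gaussWeightDeriv_le (hy : CurveCoords B c X y) (h3 : 0 < q₃) (h32 : q₃ ≤ q₂)
    (h21 : q₂ ≤ q₁) {a b : ℝ} (hab : a ≤ b) (hI : Icc a b ⊆ Icc (-1) 1)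
    (hshort : B * (b - a) ≤ c / 2) :
    ∫ s in a..b, |gaussWeightDeriv q₁ q₂ q₃ y s| ≤ 48 * (B / c) ^ 2 + 12 := by
  have h2 : 0 < q₂ := h3.trans_le h32
  have h1 : 0 < q₁ := h2.trans_le h21
  have hcX : c / 2 * X ≤ c * X := by nlinarith [mul_pos hy.c_pos hy.X_pos]
  have hlen : b - a ≤ 2 := by
    have := (hI (left_mem_Icc.2 hab)).1
    have := (hI (right_mem_Icc.2 hab)).2
    linarith
  set m := gaussWeight q₁ q₂ q₃ y with hm
  have hm0 : ∀ s, 0 ≤ m s := fun s => (exp_pos _).le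
  set T : ℝ → ℕ → ℕ → ℝ → ℝ := fun q i j s => m s * (2 * q * (|y i s| * |y j s|)) with hT
  have cm : ContinuousOn m (Icc a b) := hy.continuousOn_gaussWeight.mono hI
  have cT : ∀ q, ∀ i ≤ 4, ∀ j ≤ 4, ContinuousOn (T q i j) (Icc a b) := by
    intro q i hi j hj
    have ci := (hy.cont i hi).mono hI
    have cj := (hy.cont j hj).mono hI
    fun_prop
  -- The pointwise bound is multiplied by the length b - a ≤ 2. Both alternatives are relaxed to the
  -- common bound 16 (B/c)² + 4, and three terms give 48 (B/c)² + 12.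
  have hconst : ∀ f : ℝ → ℝ, ContinuousOn f (Icc a b) →
      (∀ s ∈ Icc a b, f s ≤ 8 * (B / c) ^ 2) → ∫ s in a..b, f s ≤ 16 * (B / c) ^ 2 + 4 := by
    intro f hf hle
    have := intervalIntegral.integral_mono_on (μ := volume) hab (hf.intervalIntegrable_of_Icc hab)
      (intervalIntegrable_const (c := 8 * (B / c) ^ 2)) hle
    rw [intervalIntegral.integral_const, smul_eq_mul] at this
    nlinarith [sq_nonneg (B / c)]
  have hslope : ∀ f : ℝ → ℝ, (∫ s in a..b, f s ≤ 4) → ∫ s in a..b, f s ≤ 16 * (B / c) ^ 2 + 4 :=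
    fun f hf => by nlinarith [sq_nonneg (B / c)]
  have b1 : ∀ s, T q₁ 1 2 s ≤ gaussSlope q₁ (y 1 s) * |y 2 s| := by
    intro s
    have : m s ≤ exp (-q₁ * y 1 s ^ 2) := exp_le_exp.2 (by
      nlinarith [mul_nonneg h2.le (sq_nonneg (y 2 s)), mul_nonneg h3.le (sq_nonneg (y 3 s))])
    calc m s * (2 * q₁ * (|y 1 s| * |y 2 s|))
        ≤ exp (-q₁ * y 1 s ^ 2) * (2 * q₁ * (|y 1 s| * |y 2 s|)) :=
          mul_le_mul_of_nonneg_right this (by positivity)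
      _ = _ := by rw [gaussSlope]; ring
  have b2 : ∀ s, T q₂ 2 3 s ≤ gaussSlope q₂ (y 2 s) * |y 3 s| := by
    intro s
    have : m s ≤ exp (-q₂ * y 2 s ^ 2) := exp_le_exp.2 (by
      nlinarith [mul_nonneg h1.le (sq_nonneg (y 1 s)), mul_nonneg h3.le (sq_nonneg (y 3 s))])
    calc m s * (2 * q₂ * (|y 2 s| * |y 3 s|))
        ≤ exp (-q₂ * y 2 s ^ 2) * (2 * q₂ * (|y 2 s| * |y 3 s|)) :=
          mul_le_mul_of_nonneg_right this (by positivity)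
      _ = _ := by rw [gaussSlope]; ring
  have t3 : ∫ s in a..b, T q₃ 3 4 s ≤ 16 * (B / c) ^ 2 + 4 := by
    refine hconst _ (cT _ 3 (by norm_num) 4 (by norm_num)) fun s hs => ?_
    refine hy.gaussWeight_mul_le h1.le h2.le h3.le h3.le (by norm_num) (by norm_num) (hI hs) ?_
    exact (hy.lower s (hI hs)).imp (fun h => ⟨h32.trans h21, hcX.trans h⟩)
      (Or.imp (fun h => ⟨h32, hcX.trans h⟩) (fun h => ⟨le_rfl, hcX.trans h⟩))
  have t2 : ∫ s in a..b, T q₂ 2 3 s ≤ 16 * (B / c) ^ 2 + 4 := by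
    rcases hy.exists_lower hab hI hshort with h | h | h
    · exact hconst _ (cT _ 2 (by norm_num) 3 (by norm_num)) fun s hs =>
        hy.gaussWeight_mul_le h1.le h2.le h3.le h2.le (by norm_num) (by norm_num) (hI hs)
          (.inl ⟨h21, h s hs⟩)
    · exact hconst _ (cT _ 2 (by norm_num) 3 (by norm_num)) fun s hs =>
        hy.gaussWeight_mul_le h1.le h2.le h3.le h2.le (by norm_num) (by norm_num) (hI hs)
          (.inr (.inl ⟨le_rfl, h s hs⟩))
    · exact hslope _ (hy.integral_le_of_coversAtMost hab hI (by norm_num) h2 one_le_two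
        (hy.coversAtMost_one hab hI (by norm_num) h) (cT _ 2 (by norm_num) 3 (by norm_num))
        fun s _ => b2 s)
  have t1 : ∫ s in a..b, T q₁ 1 2 s ≤ 16 * (B / c) ^ 2 + 4 := by
    rcases hy.exists_lower hab hI hshort with h | h | h
    · exact hconst _ (cT _ 1 (by norm_num) 2 (by norm_num)) fun s hs =>
        hy.gaussWeight_mul_le h1.le h2.le h3.le h1.le (by norm_num) (by norm_num) (hI hs)
          (.inl ⟨le_rfl, h s hs⟩)
    · exact hslope _ (hy.integral_le_of_coversAtMost hab hI (by norm_num) h1 one_le_two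
        (hy.coversAtMost_one hab hI (by norm_num) h) (cT _ 1 (by norm_num) 2 (by norm_num))
        fun s _ => b1 s)
    · exact hslope _ (hy.integral_le_of_coversAtMost hab hI (by norm_num) h1 le_rfl
        (hy.coversAtMost_two hab hI (by norm_num) h) (cT _ 1 (by norm_num) 2 (by norm_num))
        fun s _ => b1 s)
  have i1 := (cT q₁ 1 (by norm_num) 2 (by norm_num)).intervalIntegrable_of_Icc (μ := volume) hab
  have i2 := (cT q₂ 2 (by norm_num) 3 (by norm_num)).intervalIntegrable_of_Icc (μ := volume) hab
  have i3 := (cT q₃ 3 (by norm_num) 4 (by norm_num)).intervalIntegrable_of_Icc (μ := volume) hab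
  have hle : ∫ s in a..b, |gaussWeightDeriv q₁ q₂ q₃ y s|
      ≤ ∫ s in a..b, (T q₁ 1 2 s + T q₂ 2 3 s + T q₃ 3 4 s) := by
    refine intervalIntegral.integral_mono_on hab
      (((hy.continuousOn_gaussWeightDeriv.mono hI).abs).intervalIntegrable_of_Icc hab)
      ((i1.add i2).add i3) fun s _ => ?_
    rw [gaussWeightDeriv, abs_mul, abs_neg, abs_of_nonneg (hm0 s), hT]
    simp only
    rw [← mul_add, ← mul_add]
    refine mul_le_mul_of_nonneg_left ((abs_add_three _ _ _).trans (le_of_eq ?_)) (hm0 s)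
    simp only [abs_mul, abs_of_pos h1, abs_of_pos h2, abs_of_pos h3, abs_two]
  rw [intervalIntegral.integral_add (i1.add i2) i3, intervalIntegral.integral_add i1 i2] at hle
  linarith

end CurveCoords
end CurveCoordinates

/-! ### Squared increments of the symbol along the dyadic grid. -/

section Variation
open FourierTransform Real

/-- If the integral over each piece of a uniform partition is at most `M`, the whole integral is
at most the number of pieces times `M`. -/
theorem integral_le_card_mul {W : ℝ → ℝ} (hW : ContinuousOn W (Icc (-1) 1)) {n : ℕ} (hn : n ≠ 0)
    {M : ℝ} (h : ∀ a b : ℝ, a ≤ b → Icc a b ⊆ Icc (-1) 1 → b - a ≤ 2 / n → ∫ s in a..b, W s ≤ M) :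
    ∫ s in (-1 : ℝ)..1, W s ≤ n * M := by
  have hn0 : (0 : ℝ) < n := by positivity
  set g : ℕ → ℝ := fun i => -1 + 2 * i / n with hg
  have hgl : ∀ i, -1 ≤ g i := fun i => by
    have : (0 : ℝ) ≤ 2 * i / n := by positivity
    simp only [hg]; linarith
  have hgu : ∀ i ≤ n, g i ≤ 1 := fun i hi => by
    have : 2 * (i : ℝ) / n ≤ 2 := by
      rw [div_le_iff₀ hn0]
      have : (i : ℝ) ≤ n := by exact_mod_cast hi
      linarith
    simp only [hg]; linarith
  have hstep : ∀ i, g (i + 1) - g i = 2 / n := fun i => by simp only [hg]; push_cast; ring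
  have hmono : ∀ i, g i ≤ g (i + 1) := fun i => by
    have := hstep i
    have h2 : 0 < 2 / (n : ℝ) := by positivity
    linarith
  have hsub : ∀ i < n, Icc (g i) (g (i + 1)) ⊆ Icc (-1) 1 := fun i hi =>
    Icc_subset_Icc (hgl i) (hgu _ hi)
  have hsum := intervalIntegral.sum_integral_adjacent_intervals (f := W) (μ := volume) (a := g)
    (n := n) fun i hi => (hW.mono (hsub i hi)).intervalIntegrable_of_Icc (hmono i)
  have h0 : g 0 = -1 := by simp [hg]
  have h1 : g n = 1 := by simp only [hg]; field_simp; norm_num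
  rw [h0, h1] at hsum
  rw [← hsum]
  calc _ ≤ ∑ _i ∈ Finset.range n, M := Finset.sum_le_sum fun i hi => by
        have hi := Finset.mem_range.1 hi
        exact h _ _ (hmono i) (hsub i hi) (hstep i).le
    _ = n * M := by simp

/-- The points of the dyadic grid of generation `k` in `[-1, 1]`. -/
noncomputable def dyadicPoint (k j : ℕ) : ℝ := -1 + 2 * j / 2 ^ k

theorem dyadicPoint_zero (k : ℕ) : dyadicPoint k 0 = -1 := by simp [dyadicPoint]

theorem dyadicPoint_top (k : ℕ) : dyadicPoint k (2 ^ k) = 1 := by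
  simp only [dyadicPoint]; push_cast; field_simp; norm_num

theorem dyadicPoint_succ_even (k j : ℕ) : dyadicPoint (k + 1) (2 * j) = dyadicPoint k j := by
  simp only [dyadicPoint, pow_succ]; push_cast; field_simp

theorem dyadicPoint_mono (k : ℕ) : Monotone (dyadicPoint k) := by
  intro i j hij
  have : (i : ℝ) ≤ j := by exact_mod_cast hij
  simp only [dyadicPoint]
  gcongr

theorem dyadicPoint_mem (k : ℕ) {j : ℕ} (hj : j ≤ 2 ^ k) : dyadicPoint k j ∈ Icc (-1 : ℝ) 1 :=
  ⟨dyadicPoint_zero k ▸ dyadicPoint_mono k (Nat.zero_le j), dyadicPoint_top k ▸ dyadicPoint_mono k hj⟩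

/-- The intervals on the left are the left halves of the intervals of generation k, hence
non-overlapping. -/
theorem sum_integral_dyadic_le {W : ℝ → ℝ} (hW : ContinuousOn W (Icc (-1) 1))
    (h0 : ∀ s ∈ Icc (-1 : ℝ) 1, 0 ≤ W s) (k : ℕ) :
    ∑ i ∈ Finset.range (2 ^ k), ∫ s in dyadicPoint (k + 1) (2 * i)..dyadicPoint (k + 1) (2 * i + 1), W s
      ≤ ∫ s in (-1 : ℝ)..1, W s := by
  have hsub : ∀ i < 2 ^ k, Icc (dyadicPoint k i) (dyadicPoint k (i + 1)) ⊆ Icc (-1) 1 := fun i hi =>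
    Icc_subset_Icc (dyadicPoint_mem k hi.le).1 (dyadicPoint_mem k hi).2
  have hsum := intervalIntegral.sum_integral_adjacent_intervals (f := W) (μ := volume)
    (a := dyadicPoint k) (n := 2 ^ k) fun i hi => (hW.mono (hsub i hi)).intervalIntegrable_of_Icc
      (dyadicPoint_mono k (Nat.le_succ i))
  rw [dyadicPoint_zero, dyadicPoint_top] at hsum
  rw [← hsum]
  refine Finset.sum_le_sum fun i hi => ?_
  have hi := Finset.mem_range.1 hi
  have hle : dyadicPoint (k + 1) (2 * i + 1) ≤ dyadicPoint k (i + 1) := by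
    rw [← dyadicPoint_succ_even k (i + 1)]
    exact dyadicPoint_mono _ (by omega)
  have hmid : dyadicPoint (k + 1) (2 * i) ≤ dyadicPoint (k + 1) (2 * i + 1) :=
    dyadicPoint_mono _ (Nat.le_succ _)
  have hsub := hsub i hi
  rw [← dyadicPoint_succ_even k i] at hsub ⊢
  refine intervalIntegral.integral_mono_interval le_rfl hmid hle ?_ ?_
  · refine (ae_restrict_iff' measurableSet_Ioc).2 (.of_forall fun s hs => h0 s ?_)
    exact hsub (Ioc_subset_Icc_self hs)
  · exact (hW.mono hsub).intervalIntegrable_of_Icc (hmid.trans hle)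

namespace CurveCoords

variable {B c X : ℝ} {y : ℕ → ℝ → ℝ} {q₁ q₂ q₃ : ℝ} {h : ℝ → ℂ}

/-- The density that controls the squared increments of the symbol along the curve. -/
noncomputable def incrementDensity (q₁ q₂ q₃ : ℝ) (y : ℕ → ℝ → ℝ) (h : ℝ → ℂ) (s : ℝ) : ℝ :=
  16 * (fourierEnergy h (y 0 s) * |y 1 s|) +
    2 * (∫ t, ‖h t‖ ^ 2) * |gaussWeightDeriv q₁ q₂ q₃ y s|

theorem incrementDensity_nonneg (s : ℝ) : 0 ≤ incrementDensity q₁ q₂ q₃ y h s := by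
  have h1 := fourierEnergy_nonneg h (y 0 s)
  have h2 : 0 ≤ ∫ t, ‖h t‖ ^ 2 := integral_nonneg fun _ => by positivity
  unfold incrementDensity
  positivity

theorem continuousOn_energy (hy : CurveCoords B c X y) (h1 : Integrable h)
    (hs : ∀ t, t ∉ Icc (1 : ℝ) 2 → h t = 0) :
    ContinuousOn (fun s => fourierEnergy h (y 0 s) * |y 1 s|) (Icc (-1) 1) :=
  ((continuous_fourierEnergy h1 hs).comp_continuousOn (hy.cont 0 (by norm_num))).mul
    (hy.cont 1 (by norm_num)).abs

theorem continuousOn_incrementDensity (hy : CurveCoords B c X y) (h1 : Integrable h)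
    (hs : ∀ t, t ∉ Icc (1 : ℝ) 2 → h t = 0) :
    ContinuousOn (incrementDensity q₁ q₂ q₃ y h) (Icc (-1) 1) :=
  ((hy.continuousOn_energy h1 hs).const_mul 16).add
    ((hy.continuousOn_gaussWeightDeriv.abs).const_mul _)

theorem gaussWeight_le_one (h1 : 0 ≤ q₁) (h2 : 0 ≤ q₂) (h3 : 0 ≤ q₃) (s : ℝ) :
    gaussWeight q₁ q₂ q₃ y s ≤ 1 := by
  unfold gaussWeight
  rw [exp_le_one_iff]
  have := mul_nonneg h1 (sq_nonneg (y 1 s))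
  have := mul_nonneg h2 (sq_nonneg (y 2 s))
  have := mul_nonneg h3 (sq_nonneg (y 3 s))
  linarith

/-- Discrete product rule: the increment of weight times transform splits into an increment of the
transform, with weight at most one, and an increment of the weight, with the transform bounded by
the L² norm of h. -/
theorem norm_sub_sq_le_integral (hy : CurveCoords B c X y) (hq₁ : 0 ≤ q₁) (hq₂ : 0 ≤ q₂)
    (hq₃ : 0 ≤ q₃) (h1 : Integrable h) (h2 : MemLp h 2 volume)
    (hs : ∀ t, t ∉ Icc (1 : ℝ) 2 → h t = 0) {a b : ℝ} (hab : a ≤ b)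
    (hI : Icc a b ⊆ Icc (-1) 1) :
    ‖(gaussWeight q₁ q₂ q₃ y b : ℂ) * 𝓕 h (y 0 b) - (gaussWeight q₁ q₂ q₃ y a : ℂ) * 𝓕 h (y 0 a)‖ ^ 2
      ≤ ∫ s in a..b, incrementDensity q₁ q₂ q₃ y h s := by
  set m := gaussWeight q₁ q₂ q₃ y with hm
  set m' := gaussWeightDeriv q₁ q₂ q₃ y with hm'
  set N := ∫ t, ‖h t‖ ^ 2 with hN
  have hm0 : ∀ s, 0 < m s := fun s => exp_pos _
  have hm1 : ∀ s, m s ≤ 1 := gaussWeight_le_one hq₁ hq₂ hq₃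
  have cE := continuous_fourierEnergy h1 hs
  have cEy : ContinuousOn (fun s => fourierEnergy h (y 0 s) * |y 1 s|) (Icc a b) :=
    (hy.continuousOn_energy h1 hs).mono hI
  have c0 := (hy.cont 0 (by norm_num)).mono hI
  have c1 := (hy.cont 1 (by norm_num)).mono hI
  have cm' : ContinuousOn m' (Icc a b) := hy.continuousOn_gaussWeightDeriv.mono hI
  -- The energy between the two endpoint values is pulled back to the parameter. `y 0` need not be
  -- monotone, so absolute values are taken after the substitution.
  have hH : ‖𝓕 h (y 0 b) - 𝓕 h (y 0 a)‖ ^ 2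
      ≤ 8 * ∫ s in a..b, fourierEnergy h (y 0 s) * |y 1 s| := by
    have key : ∫ s in a..b, (fourierEnergy h ∘ y 0) s * y 1 s
        = ∫ u in y 0 a..y 0 b, fourierEnergy h u := by
      refine intervalIntegral.integral_comp_mul_deriv''' (by rwa [uIcc_of_le hab])
        (fun x hx => ?_) cE.continuousOn (integrable_fourierEnergy h1 h2 hs).integrableOn ?_
      · rw [min_eq_left hab, max_eq_right hab] at hx
        exact (hy.hasDerivAt hI (by norm_num) hx).hasDerivWithinAt
      · rw [uIcc_of_le hab]
        exact ((cE.comp_continuousOn c0).mul c1).integrableOn_Icc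
    have habs : |∫ u in y 0 a..y 0 b, fourierEnergy h u|
        ≤ ∫ s in a..b, fourierEnergy h (y 0 s) * |y 1 s| := by
      rw [← key]
      refine (intervalIntegral.abs_integral_le_integral_abs hab).trans (le_of_eq ?_)
      refine intervalIntegral.integral_congr fun s _ => ?_
      simp [abs_mul, abs_of_nonneg (fourierEnergy_nonneg h (y 0 s))]
    rcases le_total (y 0 a) (y 0 b) with hle | hle
    · have := norm_fourier_sub_sq_le h1 hs hle
      linarith [le_abs_self (∫ u in y 0 a..y 0 b, fourierEnergy h u)]
    · have := norm_fourier_sub_sq_le h1 hs hle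
      rw [norm_sub_rev, intervalIntegral.integral_symm] at this
      linarith [neg_le_abs (∫ u in y 0 a..y 0 b, fourierEnergy h u)]
  have hmab : |m b - m a| ≤ ∫ s in a..b, |m' s| := by
    rw [← intervalIntegral.integral_eq_sub_of_hasDerivAt_of_le hab
      (hy.continuousOn_gaussWeight.mono hI) (fun s hs => hy.hasDerivAt_gaussWeight hI hs)
      (cm'.intervalIntegrable_of_Icc hab)]
    exact intervalIntegral.abs_integral_le_integral_abs hab
  -- Both values lie in (0, 1]. Giving up the square makes the total variation of the weight
  -- sufficient, with no L² bound on its derivative.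
  have hm2 : |m b - m a| ^ 2 ≤ |m b - m a| := by
    have : |m b - m a| ≤ 1 := abs_sub_le_iff.2
      ⟨by linarith [hm1 b, hm0 a], by linarith [hm1 a, hm0 b]⟩
    nlinarith [abs_nonneg (m b - m a)]
  have hHa : ‖𝓕 h (y 0 a)‖ ^ 2 ≤ N := norm_fourier_sq_le_of_band h1 h2 hs _
  have hN0 : 0 ≤ N := (sq_nonneg _).trans hHa
  have hsplit : ‖(m b : ℂ) * 𝓕 h (y 0 b) - (m a : ℂ) * 𝓕 h (y 0 a)‖ ^ 2
      ≤ 2 * (‖𝓕 h (y 0 b) - 𝓕 h (y 0 a)‖ ^ 2 + |m b - m a| * N) := by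
    have e : (m b : ℂ) * 𝓕 h (y 0 b) - (m a : ℂ) * 𝓕 h (y 0 a)
        = (m b : ℂ) * (𝓕 h (y 0 b) - 𝓕 h (y 0 a)) - ((m a - m b : ℝ) : ℂ) * 𝓕 h (y 0 a) := by
      push_cast; ring
    rw [e]
    refine (norm_sub_sq_le_two_mul _ _).trans ?_
    rw [norm_mul, norm_mul, Complex.norm_real, Complex.norm_real, Real.norm_eq_abs,
      Real.norm_eq_abs, abs_sub_comm, abs_of_pos (hm0 b), mul_pow, mul_pow]
    have k1 : m b ^ 2 * ‖𝓕 h (y 0 b) - 𝓕 h (y 0 a)‖ ^ 2 ≤ ‖𝓕 h (y 0 b) - 𝓕 h (y 0 a)‖ ^ 2 :=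
      mul_le_of_le_one_left (by positivity) (pow_le_one₀ (hm0 b).le (hm1 b))
    have k2 : |m b - m a| ^ 2 * ‖𝓕 h (y 0 a)‖ ^ 2 ≤ |m b - m a| * N :=
      mul_le_mul hm2 hHa (by positivity) (abs_nonneg _)
    linarith
  have hW : ∫ s in a..b, incrementDensity q₁ q₂ q₃ y h s
      = 16 * (∫ s in a..b, fourierEnergy h (y 0 s) * |y 1 s|) + 2 * N * ∫ s in a..b, |m' s| := by
    unfold incrementDensity
    rw [intervalIntegral.integral_add ((cEy.intervalIntegrable_of_Icc hab).const_mul 16)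
      ((cm'.abs.intervalIntegrable_of_Icc hab).const_mul _), intervalIntegral.integral_const_mul,
      intervalIntegral.integral_const_mul]
  rw [hW]
  have := mul_le_mul_of_nonneg_right hmab hN0
  linarith

/-- The number of pieces into which the parameter interval is cut. -/
noncomputable def pieces (B c : ℝ) : ℕ := ⌈4 * B / c⌉₊ + 1

/-- The constant in the variational estimate. -/
noncomputable def variationConst (B c : ℝ) : ℝ :=
  pieces B c * (64 * (1 + (4 * π) ^ 2) + 2 * (48 * (B / c) ^ 2 + 12))

theorem integral_incrementDensity_le (hy : CurveCoords B c X y) (h3 : 0 < q₃) (h32 : q₃ ≤ q₂)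
    (h21 : q₂ ≤ q₁) (h1 : Integrable h) (h2 : MemLp h 2 volume)
    (hs : ∀ t, t ∉ Icc (1 : ℝ) 2 → h t = 0) :
    ∫ s in (-1 : ℝ)..1, incrementDensity q₁ q₂ q₃ y h s
      ≤ variationConst B c * ∫ t, ‖h t‖ ^ 2 := by
  have hB := hy.B_pos
  have hc := hy.c_pos
  rw [variationConst, mul_assoc]
  refine integral_le_card_mul (hy.continuousOn_incrementDensity h1 hs) (Nat.succ_ne_zero _) ?_
  intro a b hab hI hlen
  have hshort : B * (b - a) ≤ c / 2 := by
    have hn : 4 * B / c ≤ pieces B c := by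
      unfold pieces; push_cast
      linarith [Nat.le_ceil (4 * B / c)]
    have hn0 : (0 : ℝ) < pieces B c := lt_of_lt_of_le (by positivity) hn
    rw [div_le_iff₀ hc] at hn
    have h2 : (b - a) * pieces B c ≤ 2 := (le_div_iff₀ hn0).1 hlen
    have : B * (b - a) * pieces B c ≤ c / 2 * pieces B c := by nlinarith
    exact le_of_mul_le_mul_right this hn0
  have hN0 : 0 ≤ ∫ t, ‖h t‖ ^ 2 := integral_nonneg fun _ => by positivity
  -- Fourfold covering times the factor 16 of the density produces the 64 in `variationConst`.
  have e1 := hy.coversAtMost_four hab hI hshort _ (continuous_fourierEnergy h1 hs)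
    (fourierEnergy_nonneg h) (integrable_fourierEnergy h1 h2 hs)
  have e2 := hy.integral_abs_gaussWeightDeriv_le h3 h32 h21 hab hI hshort
  have e3 := integral_fourierEnergy_le h1 h2 hs
  have cEy : ContinuousOn (fun s => fourierEnergy h (y 0 s) * |y 1 s|) (Icc a b) :=
    (hy.continuousOn_energy h1 hs).mono hI
  have cm' : ContinuousOn (gaussWeightDeriv q₁ q₂ q₃ y) (Icc a b) :=
    hy.continuousOn_gaussWeightDeriv.mono hI
  unfold incrementDensity
  rw [intervalIntegral.integral_add ((cEy.intervalIntegrable_of_Icc hab).const_mul 16)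
      ((cm'.abs.intervalIntegrable_of_Icc hab).const_mul _), intervalIntegral.integral_const_mul,
      intervalIntegral.integral_const_mul]
  have := mul_le_mul_of_nonneg_left e2 hN0
  linarith

/-- The sum of the squared increments of the symbol over one generation of dyadic intervals. -/
theorem sum_norm_sub_sq_le (hy : CurveCoords B c X y) (h3 : 0 < q₃) (h32 : q₃ ≤ q₂)
    (h21 : q₂ ≤ q₁) (h1 : Integrable h) (h2 : MemLp h 2 volume)
    (hs : ∀ t, t ∉ Icc (1 : ℝ) 2 → h t = 0) (k : ℕ) :
    ∑ i ∈ Finset.range (2 ^ k),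
      ‖(gaussWeight q₁ q₂ q₃ y (dyadicPoint (k + 1) (2 * i + 1)) : ℂ) *
          𝓕 h (y 0 (dyadicPoint (k + 1) (2 * i + 1))) -
        (gaussWeight q₁ q₂ q₃ y (dyadicPoint (k + 1) (2 * i)) : ℂ) *
          𝓕 h (y 0 (dyadicPoint (k + 1) (2 * i)))‖ ^ 2
      ≤ variationConst B c * ∫ t, ‖h t‖ ^ 2 := by
  have hq2 := h3.trans_le h32
  refine le_trans (Finset.sum_le_sum fun i hi => ?_)
    ((sum_integral_dyadic_le (hy.continuousOn_incrementDensity h1 hs)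
      (fun s _ => incrementDensity_nonneg s) k).trans
      (hy.integral_incrementDensity_le h3 h32 h21 h1 h2 hs))
  have hi := Finset.mem_range.1 hi
  refine hy.norm_sub_sq_le_integral (hq2.trans_le h21).le hq2.le h3.le h1 h2 hs
    (dyadicPoint_mono _ (Nat.le_succ _)) (Icc_subset_Icc ?_ ?_)
  · exact (dyadicPoint_mem _ (by rw [pow_succ]; omega)).1
  · exact (dyadicPoint_mem _ (by rw [pow_succ]; omega)).2

end CurveCoords
end Variation

/-! ### Gaussian averages over moving ellipsoids and their Fourier multipliers. -/

section GaussianAverages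
open FourierTransform Real

variable {V : Type*} [NormedAddCommGroup V] [InnerProductSpace ℝ V] [FiniteDimensional ℝ V]
  [MeasurableSpace V] [BorelSpace V]

theorem memLp_two_of_bounded {α : Type*} [MeasurableSpace α] {μ : Measure α} {f : α → ℂ}
    (h1 : Integrable f μ) {A : ℝ} (hA : ∀ x, ‖f x‖ ≤ A) : MemLp f 2 μ := by
  refine (memLp_two_iff_integrable_sq_norm h1.1).2
    ((h1.norm.const_mul A).mono' (h1.1.norm.pow 2) (.of_forall fun x => ?_))
  rw [Real.norm_of_nonneg (by positivity), pow_two]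
  exact mul_le_mul_of_nonneg_right (hA x) (norm_nonneg _)

theorem fourier_sub_of_integrable {f g : V → ℂ} (hf : Integrable f) (hg : Integrable g) (ξ : V) :
    𝓕 (f - g) ξ = 𝓕 f ξ - 𝓕 g ξ := by
  simp only [Real.fourier_eq]
  rw [← integral_sub]
  · simp [smul_sub]
  · exact (Real.fourierIntegral_convergent_iff ξ).2 hf
  · exact (Real.fourierIntegral_convergent_iff ξ).2 hg

variable (V) in
/-- The standard Gaussian measure with density `exp (-π ‖w‖ ^ 2)`. -/
noncomputable def gaussMeasure : Measure V :=
  volume.withDensity fun w => ENNReal.ofReal (exp (-π * ‖w‖ ^ 2))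

theorem integral_gaussMeasure (f : V → ℂ) :
    ∫ w, f w ∂gaussMeasure V = ∫ w, (exp (-π * ‖w‖ ^ 2) : ℂ) * f w := by
  rw [gaussMeasure, integral_withDensity_eq_integral_toReal_smul
    (by fun_prop) (.of_forall fun _ => ENNReal.ofReal_lt_top)]
  refine integral_congr_ae (.of_forall fun w => ?_)
  simp [ENNReal.toReal_ofReal (exp_pos _).le]

theorem lintegral_exp_neg_pi : ∫⁻ w : V, ENNReal.ofReal (exp (-π * ‖w‖ ^ 2)) = 1 := by
  have h := GaussianFourier.integral_rexp_neg_mul_sq_norm (V := V) pi_pos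
  rw [div_self pi_ne_zero, one_rpow] at h
  have hi : Integrable fun w : V => exp (-π * ‖w‖ ^ 2) := by
    by_contra hcon
    rw [integral_undef hcon] at h
    exact zero_ne_one h
  rw [← ofReal_integral_eq_lintegral_ofReal hi (.of_forall fun _ => (exp_pos _).le), h,
    ENNReal.ofReal_one]

instance : IsProbabilityMeasure (gaussMeasure V) :=
  ⟨by rw [gaussMeasure, withDensity_apply _ MeasurableSet.univ, Measure.restrict_univ,
    lintegral_exp_neg_pi]⟩

theorem integral_fourierChar_gaussMeasure (η : V) :
    ∫ w, (fourierChar (-inner ℝ w η) : ℂ) ∂gaussMeasure V = exp (-π * ‖η‖ ^ 2) := by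
  rw [integral_gaussMeasure]
  have h := fourier_gaussian_innerProductSpace (V := V) (b := π) (by simpa using pi_pos) η
  rw [Real.fourier_eq] at h
  have hpi : (π : ℂ) ≠ 0 := by exact_mod_cast pi_ne_zero
  rw [div_self hpi, Complex.one_cpow, one_mul] at h
  have e : -(π : ℂ) ^ 2 * (‖η‖ : ℂ) ^ 2 / π = ((-π * ‖η‖ ^ 2 : ℝ) : ℂ) := by
    push_cast; field_simp
  rw [e, ← Complex.ofReal_exp] at h
  rw [← h]
  refine integral_congr_ae (.of_forall fun w => ?_)
  simp only [Circle.smul_def, smul_eq_mul]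
  push_cast
  ring

variable (V) in
/-- The product of Lebesgue measure on `[1, 2]` and the Gaussian measure. -/
noncomputable def slabGauss : Measure (ℝ × V) := (volume.restrict (Icc (1 : ℝ) 2)).prod (gaussMeasure V)

instance : IsProbabilityMeasure (volume.restrict (Icc (1 : ℝ) 2)) := ⟨by norm_num⟩

instance : IsProbabilityMeasure (slabGauss V) := by unfold slabGauss; infer_instance

/-- The displacement `t p + P w`. -/
def plateShift (p : V) (P : V →L[ℝ] V) (τ : ℝ × V) : V := τ.1 • p + P τ.2

theorem continuous_plateShift {V : Type*} [NormedAddCommGroup V] [InnerProductSpace ℝ V]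
    (p : V) (P : V →L[ℝ] V) : Continuous (plateShift p P) := by
  unfold plateShift; fun_prop

/-- The average of `f` over a smoothed plate. -/
noncomputable def gaussAverage (p : V) (P : V →L[ℝ] V) (f : V × ℝ → ℂ) (x : V) : ℂ :=
  ∫ τ, f (x - plateShift p P τ, τ.1) ∂slabGauss V

/-- The Fourier transform in the space variables, restricted to times in `[1, 2]`. -/
noncomputable def sliceFourier (f : V × ℝ → ℂ) (ξ : V) : ℝ → ℂ :=
  (Icc (1 : ℝ) 2).indicator fun t => 𝓕 (fun x => f (x, t)) ξ

/-- Bounded measurable functions with bounded support in the space variables. -/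
structure BoundedSupp (f : V × ℝ → ℂ) : Prop where
  meas : Measurable f
  bound : ∃ A : ℝ, ∀ z, ‖f z‖ ≤ A
  supp : ∃ R : ℝ, ∀ x t, R < ‖x‖ → f (x, t) = 0

namespace BoundedSupp

variable {f : V × ℝ → ℂ} (hf : BoundedSupp f) (p : V) (P : V →L[ℝ] V)
include hf

theorem exists_integral_le : ∃ A : ℝ, ∀ z : V, ∀ t, Integrable (fun x => f (x - z, t)) ∧
    ∫ x, ‖f (x - z, t)‖ ≤ A := by
  obtain ⟨A, hA⟩ := hf.bound
  obtain ⟨R, hR⟩ := hf.supp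
  have hA0 : 0 ≤ A := (norm_nonneg _).trans (hA 0)
  have hle : ∀ t, ∀ x, ‖f (x, t)‖ ≤ (Metric.closedBall (0 : V) R).indicator (fun _ => A) x := by
    intro t x
    by_cases hx : x ∈ Metric.closedBall (0 : V) R
    · rw [indicator_of_mem hx]; exact hA _
    · rw [indicator_of_notMem hx, hR x t (by simpa using hx), norm_zero]
  have hint : Integrable ((Metric.closedBall (0 : V) R).indicator fun _ => A) :=
    (integrable_indicator_iff measurableSet_closedBall).2
      (integrableOn_const (measure_closedBall_lt_top.ne))
  have hi : ∀ t, Integrable fun x => f (x, t) := fun t =>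
    hint.mono' (hf.meas.comp measurable_prodMk_right).aestronglyMeasurable (.of_forall (hle t))
  refine ⟨∫ x, (Metric.closedBall (0 : V) R).indicator (fun _ => A) x, fun z t => ⟨?_, ?_⟩⟩
  · exact (hi t).comp_sub_right z
  · rw [integral_sub_right_eq_self (fun x => ‖f (x, t)‖) z]
    exact integral_mono (hi t).norm hint (hle t)

theorem integrable_slice (t : ℝ) : Integrable fun x => f (x, t) := by
  obtain ⟨A, hA⟩ := hf.exists_integral_le
  simpa using (hA 0 t).1

theorem memLp_slice (t : ℝ) : MemLp (fun x => f (x, t)) 2 volume := by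
  obtain ⟨A, hA⟩ := hf.bound
  exact memLp_two_of_bounded (hf.integrable_slice t) fun x => hA _

theorem measurable_shift : Measurable fun z : V × (ℝ × V) => f (z.1 - plateShift p P z.2, z.2.1) := by
  have h := (continuous_plateShift p P).measurable
  exact hf.meas.comp ((measurable_fst.sub (h.comp measurable_snd)).prodMk
    (measurable_fst.comp measurable_snd))

theorem integrable_shift : Integrable (fun z : V × (ℝ × V) => f (z.1 - plateShift p P z.2, z.2.1))
    (volume.prod (slabGauss V)) := by
  have hm := (hf.measurable_shift p P)
  obtain ⟨A, hA⟩ := hf.exists_integral_le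
  refine (integrable_prod_iff' hm.aestronglyMeasurable).2 ⟨.of_forall fun τ => (hA (plateShift p P τ) τ.1).1, ?_⟩
  refine Integrable.of_bound ?_ A (.of_forall fun τ => ?_)
  · exact (hm.norm.stronglyMeasurable.integral_prod_left'
      (μ := (volume : Measure V))).aestronglyMeasurable
  · rw [Real.norm_of_nonneg (integral_nonneg fun _ => norm_nonneg _)]
    exact (hA (plateShift p P τ) τ.1).2

theorem integrable_gaussAverage : Integrable (gaussAverage p P f) :=
  (hf.integrable_shift p P).integral_prod_left

theorem exists_bound_gaussAverage : ∃ A : ℝ, ∀ x, ‖gaussAverage p P f x‖ ≤ A := by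
  obtain ⟨A, hA⟩ := hf.bound
  refine ⟨A, fun x => ?_⟩
  have := norm_integral_le_of_norm_le_const (μ := slabGauss V) (C := A)
    (f := fun τ => f (x - plateShift p P τ, τ.1)) (.of_forall fun τ => hA _)
  simpa [gaussAverage] using this

theorem memLp_gaussAverage : MemLp (gaussAverage p P f) 2 volume := by
  obtain ⟨A, hA⟩ := hf.exists_bound_gaussAverage p P
  exact memLp_two_of_bounded (hf.integrable_gaussAverage p P) hA

theorem stronglyMeasurable_fourier_slice :
    StronglyMeasurable fun z : V × ℝ => 𝓕 (fun x => f (x, z.2)) z.1 := by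
  simp only [Real.fourier_eq]
  refine StronglyMeasurable.integral_prod_right
    (f := fun (z : V × ℝ) x => fourierChar (-inner ℝ x z.1) • f (x, z.2)) ?_
  have h1 : Continuous fun q : (V × ℝ) × V => (fourierChar (-inner ℝ q.2 q.1.1) : ℂ) := by
    fun_prop
  have h2 : Measurable fun q : (V × ℝ) × V => f (q.2, q.1.2) :=
    hf.meas.comp (measurable_snd.prodMk (measurable_snd.comp measurable_fst))
  exact (h1.measurable.mul h2).stronglyMeasurable

theorem measurable_fourier_slice (ξ : V) : Measurable fun t : ℝ => 𝓕 (fun x => f (x, t)) ξ := by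
  have key : ∀ F : V → ℝ → ℂ, Measurable (fun z : V × ℝ => F z.1 z.2) → Measurable (F ξ) :=
    fun F h => h.comp measurable_prodMk_left
  exact key (fun ξ t => 𝓕 (fun x => f (x, t)) ξ) hf.stronglyMeasurable_fourier_slice.measurable

theorem exists_bound_fourier_slice : ∃ A : ℝ, ∀ ξ t, ‖𝓕 (fun x => f (x, t)) ξ‖ ≤ A := by
  obtain ⟨A, hA⟩ := hf.exists_integral_le
  refine ⟨A, fun ξ t => (norm_fourier_le_integral_norm _ ξ).trans ?_⟩
  simpa using (hA 0 t).2

theorem integrable_sliceFourier (ξ : V) : Integrable (sliceFourier f ξ) := by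
  obtain ⟨A, hA⟩ := hf.exists_bound_fourier_slice
  refine (integrable_indicator_iff measurableSet_Icc).2 ?_
  exact Integrable.of_bound (hf.measurable_fourier_slice ξ).aestronglyMeasurable A
    (.of_forall (hA ξ))

theorem memLp_sliceFourier (ξ : V) : MemLp (sliceFourier f ξ) 2 volume := by
  obtain ⟨A, hA⟩ := hf.exists_bound_fourier_slice
  refine memLp_two_of_bounded (hf.integrable_sliceFourier ξ) (A := A) fun t => ?_
  exact (norm_indicator_le_norm_self _ _).trans (hA ξ t)

/-- The Fourier transform of a smoothed plate average. -/
theorem fourier_gaussAverage (ξ : V) : 𝓕 (gaussAverage p P f) ξ =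
    (exp (-π * ‖P.adjoint ξ‖ ^ 2) : ℂ) * 𝓕 (sliceFourier f ξ) (inner ℝ p ξ) := by
  have hswap : 𝓕 (gaussAverage p P f) ξ =
      ∫ τ, (∫ x, fourierChar (-inner ℝ x ξ) • f (x - plateShift p P τ, τ.1)) ∂slabGauss V := by
    rw [Real.fourier_eq]
    simp only [gaussAverage, Circle.smul_def, ← integral_smul]
    refine integral_integral_swap
      (f := fun x τ => (fourierChar (-inner ℝ x ξ) : ℂ) • f (x - plateShift p P τ, τ.1)) ?_
    refine (hf.integrable_shift p P).mono ?_ (.of_forall fun z => ?_)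
    · have h1 : Continuous fun q : V × (ℝ × V) => (fourierChar (-inner ℝ q.1 ξ) : ℂ) := by
        fun_prop
      exact (h1.measurable.smul (hf.measurable_shift p P)).aestronglyMeasurable
    · simp [Function.uncurry, Circle.norm_coe]
  -- Translation in x releases a character that factors into a part in t and a part in w. The first
  -- turns the time integral into a Fourier transform at ⟨p, ξ⟩; the second gives the transform of
  -- the Gaussian at P*ξ.
  have hinner : ∀ τ : ℝ × V, ∫ x, fourierChar (-inner ℝ x ξ) • f (x - plateShift p P τ, τ.1) =
      ((fourierChar (-(τ.1 * inner ℝ p ξ)) : ℂ) * 𝓕 (fun x => f (x, τ.1)) ξ) *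
        (fourierChar (-inner ℝ τ.2 (P.adjoint ξ)) : ℂ) := by
    intro τ
    rw [← integral_add_right_eq_self _ (plateShift p P τ), Real.fourier_eq,
      ← integral_const_mul, ← integral_mul_const]
    refine integral_congr_ae (.of_forall fun x => ?_)
    have e : -inner ℝ (x + plateShift p P τ) ξ =
        -(τ.1 * inner ℝ p ξ) + -inner ℝ x ξ + -inner ℝ τ.2 (P.adjoint ξ) := by
      rw [ContinuousLinearMap.adjoint_inner_right]
      simp only [plateShift, inner_add_left, inner_smul_left]
      simp; ring
    simp only [e, add_sub_cancel_right, AddChar.map_add_eq_mul, Circle.smul_def, Circle.coe_mul,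
      smul_eq_mul]
    ring
  rw [hswap]
  simp only [hinner]
  rw [slabGauss, integral_prod_mul
    (f := fun t : ℝ => (fourierChar (-(t * inner ℝ p ξ)) : ℂ) * 𝓕 (fun x => f (x, t)) ξ)
    (g := fun w => (fourierChar (-inner ℝ w (P.adjoint ξ)) : ℂ)),
    integral_fourierChar_gaussMeasure, mul_comm, Real.fourier_eq, ← integral_indicator measurableSet_Icc]
  congr 1
  refine integral_congr_ae (.of_forall fun t => ?_)
  by_cases ht : t ∈ Icc (1 : ℝ) 2
  · simp [sliceFourier, ht, Circle.smul_def, mul_comm]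
  · simp [sliceFourier, ht]

/-- Plancherel's theorem in the space variables, integrated over `[1, 2]`. -/
theorem lintegral_sliceFourier_le :
    ∫⁻ ξ, ENNReal.ofReal (∫ t, ‖sliceFourier f ξ t‖ ^ 2) ≤ ∫⁻ z, ‖f z‖ₑ ^ 2 := by
  have e : ∀ ξ, ENNReal.ofReal (∫ t, ‖sliceFourier f ξ t‖ ^ 2)
      = ∫⁻ t in Icc (1 : ℝ) 2, ‖𝓕 (fun x => f (x, t)) ξ‖ₑ ^ 2 := by
    intro ξ
    rw [ofReal_integral_eq_lintegral_ofReal (hf.memLp_sliceFourier ξ).integrable_sq_norm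
      (.of_forall fun _ => by positivity), ← lintegral_indicator measurableSet_Icc]
    refine lintegral_congr fun t => ?_
    rw [ENNReal.ofReal_pow (norm_nonneg _), ofReal_norm]
    by_cases ht : t ∈ Icc (1 : ℝ) 2 <;> simp [sliceFourier, ht]
  simp only [e]
  have hm := hf.stronglyMeasurable_fourier_slice.measurable
  rw [lintegral_lintegral_swap (f := fun ξ t => ‖𝓕 (fun x => f (x, t)) ξ‖ₑ ^ 2)
    ((hm.enorm.pow_const 2).aemeasurable)]
  simp only [lintegral_enorm_fourier_sq (hf.integrable_slice _) (hf.memLp_slice _)]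
  refine (setLIntegral_le_lintegral _ _).trans (le_of_eq ?_)
  rw [Measure.volume_eq_prod, lintegral_prod_symm _ (hf.meas.enorm.pow_const 2).aemeasurable]

end BoundedSupp
end GaussianAverages

/-! ### Dyadic chaining and the maximal inequality for Gaussian averages. -/

section MaximalEstimate
open FourierTransform Real

/-- Dyadic chaining: values on the grid are controlled by the increments of all generations. -/
theorem norm_dyadicPoint_le (F : ℝ → ℂ) (K : ℕ) : ∀ j < 2 ^ K, ‖F (dyadicPoint K j)‖ ≤ ‖F (-1)‖ +
    ∑ k ∈ Finset.range K, √(∑ i ∈ Finset.range (2 ^ k),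
      ‖F (dyadicPoint (k + 1) (2 * i + 1)) - F (dyadicPoint (k + 1) (2 * i))‖ ^ 2) := by
  induction K with
  | zero =>
    intro j hj
    have : j = 0 := by simpa using hj
    simp [this, dyadicPoint_zero]
  | succ K ih =>
    intro j hj
    rw [Finset.sum_range_succ, ← add_assoc]
    rw [pow_succ] at hj
    -- An even point already belongs to the previous generation; an odd one is reached from its left
    -- neighbour by a single increment.
    rcases Nat.even_or_odd' j with ⟨i, rfl | rfl⟩
    · rw [dyadicPoint_succ_even]
      exact (ih i (by omega)).trans (le_add_of_nonneg_right (Real.sqrt_nonneg _))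
    · have h1 := ih i (by omega)
      rw [← dyadicPoint_succ_even] at h1
      have h2 : ‖F (dyadicPoint (K + 1) (2 * i + 1)) - F (dyadicPoint (K + 1) (2 * i))‖ ≤
          √(∑ i ∈ Finset.range (2 ^ K),
            ‖F (dyadicPoint (K + 1) (2 * i + 1)) - F (dyadicPoint (K + 1) (2 * i))‖ ^ 2) := by
        refine Real.le_sqrt_of_sq_le ?_
        exact Finset.single_le_sum (f := fun i => ‖F (dyadicPoint (K + 1) (2 * i + 1)) -
          F (dyadicPoint (K + 1) (2 * i))‖ ^ 2) (fun _ _ => by positivity)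
          (Finset.mem_range.2 (by omega))
      have h3 := norm_add_le (F (dyadicPoint (K + 1) (2 * i)))
        (F (dyadicPoint (K + 1) (2 * i + 1)) - F (dyadicPoint (K + 1) (2 * i)))
      rw [add_sub_cancel] at h3
      linarith

/-- Cauchy–Schwarz over the K + 1 terms of the chain. -/
theorem norm_dyadicPoint_sq_le (F : ℝ → ℂ) (K : ℕ) {j : ℕ} (hj : j < 2 ^ K) :
    ‖F (dyadicPoint K j)‖ ^ 2 ≤ (K + 1) * (‖F (-1)‖ ^ 2 +
      ∑ k ∈ Finset.range K, ∑ i ∈ Finset.range (2 ^ k),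
        ‖F (dyadicPoint (k + 1) (2 * i + 1)) - F (dyadicPoint (k + 1) (2 * i))‖ ^ 2) := by
  set D : ℕ → ℝ := fun k => ∑ i ∈ Finset.range (2 ^ k),
    ‖F (dyadicPoint (k + 1) (2 * i + 1)) - F (dyadicPoint (k + 1) (2 * i))‖ ^ 2 with hD
  have hD0 : ∀ k, 0 ≤ D k := fun k => Finset.sum_nonneg fun _ _ => by positivity
  -- The base value occupies the spare slot k = K, so that the chain is one sum over K + 1 indices.
  set a : ℕ → ℝ := fun k => if k = K then ‖F (-1)‖ else √(D k) with ha
  have hsum : ∑ k ∈ Finset.range (K + 1), a k = ‖F (-1)‖ + ∑ k ∈ Finset.range K, √(D k) := by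
    rw [Finset.sum_range_succ, add_comm]
    refine congrArg₂ _ (by simp [ha]) (Finset.sum_congr rfl fun k hk => ?_)
    simp [ha, (Finset.mem_range.1 hk).ne]
  have hsq : ∑ k ∈ Finset.range (K + 1), a k ^ 2 = ‖F (-1)‖ ^ 2 + ∑ k ∈ Finset.range K, D k := by
    rw [Finset.sum_range_succ, add_comm]
    refine congrArg₂ _ (by simp [ha]) (Finset.sum_congr rfl fun k hk => ?_)
    simp [ha, (Finset.mem_range.1 hk).ne, Real.sq_sqrt (hD0 k)]
  have h1 := norm_dyadicPoint_le F K j hj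
  rw [← hsum] at h1
  have h2 := sq_sum_le_card_mul_sum_sq (s := Finset.range (K + 1)) (f := a)
  rw [hsq, Finset.card_range] at h2
  push_cast at h2
  exact (pow_le_pow_left₀ (norm_nonneg _) h1 2).trans h2

theorem enorm_dyadicPoint_sq_le (F : ℝ → ℂ) (K : ℕ) {j : ℕ} (hj : j < 2 ^ K) :
    ‖F (dyadicPoint K j)‖ₑ ^ 2 ≤ (K + 1) * (‖F (-1)‖ₑ ^ 2 +
      ∑ k ∈ Finset.range K, ∑ i ∈ Finset.range (2 ^ k),
        ‖F (dyadicPoint (k + 1) (2 * i + 1)) - F (dyadicPoint (k + 1) (2 * i))‖ₑ ^ 2) := by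
  have h := ENNReal.ofReal_le_ofReal (norm_dyadicPoint_sq_le F K hj)
  rw [ENNReal.ofReal_mul (by positivity), ENNReal.ofReal_add (by positivity)
    (Finset.sum_nonneg fun _ _ => Finset.sum_nonneg fun _ _ => by positivity),
    ENNReal.ofReal_sum_of_nonneg fun _ _ => Finset.sum_nonneg fun _ _ => by positivity] at h
  simp only [ENNReal.ofReal_sum_of_nonneg fun _ _ => sq_nonneg _,
    ENNReal.ofReal_pow (norm_nonneg _), ofReal_norm] at h
  rwa [show ((K : ℝ) + 1) = ((K + 1 : ℕ) : ℝ) by push_cast; rfl, ENNReal.ofReal_natCast,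
    Nat.cast_add, Nat.cast_one] at h

variable {V : Type*} [NormedAddCommGroup V] [InnerProductSpace ℝ V] [FiniteDimensional ℝ V]
  [MeasurableSpace V] [BorelSpace V]

/-- The pairings of a non-zero frequency with the centre curve `p` and the axes of the ellipsoids
`P s` satisfy the hypotheses of the variational estimate. -/
structure PlateFamily (B c q₁ q₂ q₃ : ℝ) (p : ℝ → V) (P : ℝ → V →L[ℝ] V) : Prop where
  B_pos : 0 < B
  c_pos : 0 < c
  q₃_pos : 0 < q₃
  q₃_le : q₃ ≤ q₂
  q₂_le : q₂ ≤ q₁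
  coords : ∀ ξ : V, ξ ≠ 0 → ∃ y : ℕ → ℝ → ℝ, CurveCoords B c ‖ξ‖ y ∧
    (∀ s, y 0 s = inner ℝ (p s) ξ) ∧
    ∀ s, gaussWeight q₁ q₂ q₃ y s = exp (-π * ‖(P s).adjoint ξ‖ ^ 2)

theorem variationConst_nonneg {B c : ℝ} : 0 ≤ CurveCoords.variationConst B c := by
  unfold CurveCoords.variationConst; positivity

namespace BoundedSupp

variable {f : V × ℝ → ℂ}

/-- The Gaussian factor is at most one and the transform of the time slice is bounded by its L²
norm, so a single average is an L² contraction. This handles the starting point of the chain. -/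
theorem lintegral_gaussAverage_sq_le (hf : BoundedSupp f) (p : V) (P : V →L[ℝ] V) :
    ∫⁻ x, ‖gaussAverage p P f x‖ₑ ^ 2 ≤ ∫⁻ z, ‖f z‖ₑ ^ 2 := by
  rw [← lintegral_enorm_fourier_sq (hf.integrable_gaussAverage p P) (hf.memLp_gaussAverage p P)]
  refine le_trans (lintegral_mono fun ξ => ?_) hf.lintegral_sliceFourier_le
  rw [← ofReal_norm, ← ENNReal.ofReal_pow (norm_nonneg _)]
  refine ENNReal.ofReal_le_ofReal ?_
  have h1 := norm_fourier_sq_le_of_band (h := sliceFourier f ξ) (hf.integrable_sliceFourier ξ)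
    (hf.memLp_sliceFourier ξ) (fun t ht => indicator_of_notMem ht _) (inner ℝ p ξ)
  rw [hf.fourier_gaussAverage, norm_mul, mul_pow, Complex.norm_real,
    Real.norm_of_nonneg (exp_pos _).le]
  refine (mul_le_of_le_one_left (by positivity) (pow_le_one₀ (exp_pos _).le ?_)).trans h1
  rw [exp_le_one_iff]
  nlinarith [pi_pos, sq_nonneg ‖P.adjoint ξ‖]

/-- After Plancherel the sum over the grid moves inside the frequency integral, where the
variational estimate applies at each fixed ξ. -/
theorem sum_lintegral_sub_sq_le (hf : BoundedSupp f) {B c q₁ q₂ q₃ : ℝ} {p : ℝ → V}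
    {P : ℝ → V →L[ℝ] V} (hP : PlateFamily B c q₁ q₂ q₃ p P) (k : ℕ) [Nontrivial V] :
    ∑ i ∈ Finset.range (2 ^ k), ∫⁻ x,
      ‖gaussAverage (p (dyadicPoint (k + 1) (2 * i + 1))) (P (dyadicPoint (k + 1) (2 * i + 1))) f x -
        gaussAverage (p (dyadicPoint (k + 1) (2 * i))) (P (dyadicPoint (k + 1) (2 * i))) f x‖ₑ ^ 2
      ≤ ENNReal.ofReal (CurveCoords.variationConst B c) * ∫⁻ z, ‖f z‖ₑ ^ 2 := by
  set A : ℝ → V → ℂ := fun s => gaussAverage (p s) (P s) f with hA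
  have i1 : ∀ s, Integrable (A s) := fun s => hf.integrable_gaussAverage _ _
  have i2 : ∀ s, MemLp (A s) 2 volume := fun s => hf.memLp_gaussAverage _ _
  have hpl : ∀ s t, ∫⁻ x, ‖A s x - A t x‖ₑ ^ 2 = ∫⁻ ξ, ‖𝓕 (A s) ξ - 𝓕 (A t) ξ‖ₑ ^ 2 := by
    intro s t
    have := lintegral_enorm_fourier_sq ((i1 s).sub (i1 t)) ((i2 s).sub (i2 t))
    simp only [fourier_sub_of_integrable (i1 s) (i1 t)] at this
    exact this.symm
  change ∑ i ∈ Finset.range (2 ^ k), ∫⁻ x, ‖A (dyadicPoint (k + 1) (2 * i + 1)) x -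
    A (dyadicPoint (k + 1) (2 * i)) x‖ₑ ^ 2 ≤ _
  simp only [hpl]
  have hc : ∀ s, Continuous (𝓕 (A s)) := fun s => continuous_fourier_of_integrable (i1 s)
  rw [← lintegral_finsetSum _ fun i _ => by fun_prop]
  refine le_trans ?_ (mul_le_mul_right hf.lintegral_sliceFourier_le _)
  rw [← lintegral_const_mul' _ _ ENNReal.ofReal_ne_top]
  refine lintegral_mono_ae ?_
  -- The curve coordinates require ‖ξ‖ > 0; the origin is a null set because V is nontrivial.
  have hne : ∀ᵐ ξ : V, ξ ≠ 0 := by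
    rw [ae_iff]; simp
  filter_upwards [hne] with ξ hξ
  obtain ⟨y, hy, hy0, hyw⟩ := hP.coords ξ hξ
  rw [← ENNReal.ofReal_mul variationConst_nonneg]
  have key := hy.sum_norm_sub_sq_le hP.q₃_pos hP.q₃_le hP.q₂_le (hf.integrable_sliceFourier ξ)
    (hf.memLp_sliceFourier ξ) (fun t ht => indicator_of_notMem ht _) k
  refine le_trans (le_of_eq ?_) (ENNReal.ofReal_le_ofReal key)
  rw [ENNReal.ofReal_sum_of_nonneg fun _ _ => by positivity]
  refine Finset.sum_congr rfl fun i _ => ?_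
  rw [ENNReal.ofReal_pow (norm_nonneg _), ofReal_norm]
  simp only [hA, hf.fourier_gaussAverage, hy0, hyw]

/-- The maximal estimate over a dyadic grid, for bounded functions with bounded support. -/
theorem lintegral_iSup_gaussAverage_le (hf : BoundedSupp f) {B c q₁ q₂ q₃ : ℝ} {p : ℝ → V}
    {P : ℝ → V →L[ℝ] V} (hP : PlateFamily B c q₁ q₂ q₃ p P) (K : ℕ) [Nontrivial V] :
    ∫⁻ x, ⨆ j : Fin (2 ^ K),
      ‖gaussAverage (p (dyadicPoint K j)) (P (dyadicPoint K j)) f x‖ₑ ^ 2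
      ≤ (K + 1) * ((1 + K * ENNReal.ofReal (CurveCoords.variationConst B c)) *
        ∫⁻ z, ‖f z‖ₑ ^ 2) := by
  set A : ℝ → V → ℂ := fun s => gaussAverage (p s) (P s) f with hA
  have i1 : ∀ s, AEStronglyMeasurable (A s) volume :=
    fun s => (hf.integrable_gaussAverage _ _).aestronglyMeasurable
  have i2 : ∀ s, AEMeasurable (fun x => ‖A s x‖ₑ ^ 2) := fun s => (i1 s).enorm.pow_const 2
  have i3 : ∀ s t, AEMeasurable (fun x => ‖A s x - A t x‖ₑ ^ 2) :=
    fun s t => ((i1 s).sub (i1 t)).enorm.pow_const 2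
  calc _ ≤ ∫⁻ x, (K + 1) * (‖A (-1) x‖ₑ ^ 2 +
      ∑ k ∈ Finset.range K, ∑ i ∈ Finset.range (2 ^ k),
        ‖A (dyadicPoint (k + 1) (2 * i + 1)) x - A (dyadicPoint (k + 1) (2 * i)) x‖ₑ ^ 2) :=
        lintegral_mono fun x => iSup_le fun j => enorm_dyadicPoint_sq_le (fun s => A s x) K j.2
    _ = (K + 1) * ((∫⁻ x, ‖A (-1) x‖ₑ ^ 2) + ∑ k ∈ Finset.range K, ∑ i ∈ Finset.range (2 ^ k), ∫⁻ x,
        ‖A (dyadicPoint (k + 1) (2 * i + 1)) x - A (dyadicPoint (k + 1) (2 * i)) x‖ₑ ^ 2) := by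
        rw [lintegral_const_mul' _ _ (by finiteness), lintegral_add_left' (i2 _),
          lintegral_finsetSum' _ fun k _ => Finset.aemeasurable_fun_sum _ fun i _ => i3 _ _]
        simp only [lintegral_finsetSum' _ fun i _ => i3 _ _]
    _ ≤ (K + 1) * ((∫⁻ z, ‖f z‖ₑ ^ 2) + ∑ k ∈ Finset.range K,
          ENNReal.ofReal (CurveCoords.variationConst B c) * ∫⁻ z, ‖f z‖ₑ ^ 2) := by
        gcongr with k hk
        · exact hf.lintegral_gaussAverage_sq_le _ _
        · exact hf.sum_lintegral_sub_sq_le hP k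
    _ = _ := by
        rw [Finset.sum_const, Finset.card_range, nsmul_eq_mul]; ring

end BoundedSupp

/-- The average of a non-negative function over a smoothed plate. -/
noncomputable def gaussLAverage (p : V) (P : V →L[ℝ] V) (G : V × ℝ → ℝ≥0∞) (x : V) : ℝ≥0∞ :=
  ∫⁻ τ, G (x - plateShift p P τ, τ.1) ∂slabGauss V

theorem measurable_shift_left (p : V) (P : V →L[ℝ] V) :
    Measurable fun z : V × (ℝ × V) => (z.1 - plateShift p P z.2, z.2.1) := by
  have h := (continuous_plateShift p P).measurable
  exact (measurable_fst.sub (h.comp measurable_snd)).prodMk (measurable_fst.comp measurable_snd)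

theorem measurable_gaussLAverage (p : V) (P : V →L[ℝ] V) {G : V × ℝ → ℝ≥0∞} (hG : Measurable G) :
    Measurable (gaussLAverage p P G) :=
  (hG.comp (measurable_shift_left p P)).lintegral_prod_right'

theorem enorm_gaussAverage_toReal (p : V) (P : V →L[ℝ] V) {G : V × ℝ → ℝ≥0∞} (hG : Measurable G)
    {n : ℕ} (hn : ∀ z, G z ≤ n) (x : V) :
    ‖gaussAverage p P (fun z => ((G z).toReal : ℂ)) x‖ₑ = gaussLAverage p P G x := by
  have hfin : gaussLAverage p P G x ≠ ⊤ := by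
    have : gaussLAverage p P G x ≤ ∫⁻ _, (n : ℝ≥0∞) ∂slabGauss V := lintegral_mono fun τ => hn _
    rw [lintegral_const, measure_univ, mul_one] at this
    exact (this.trans_lt (ENNReal.natCast_lt_top n)).ne
  have hm : Measurable fun τ : ℝ × V => G (x - plateShift p P τ, τ.1) :=
    (hG.comp (measurable_shift_left p P)).comp measurable_prodMk_left
  unfold gaussAverage
  simp only
  rw [integral_complex_ofReal (f := fun τ : ℝ × V => (G (x - plateShift p P τ, τ.1)).toReal),
    integral_toReal hm.aemeasurable
    (.of_forall fun τ => (hn _).trans_lt (ENNReal.natCast_lt_top n))]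
  change ‖((gaussLAverage p P G x).toReal : ℂ)‖ₑ = _
  rw [← ofReal_norm, Complex.norm_real, Real.norm_of_nonneg ENNReal.toReal_nonneg,
    ENNReal.ofReal_toReal hfin]

/-- The maximal estimate over a dyadic grid, for non-negative functions. -/
theorem lintegral_iSup_gaussLAverage_le {B c q₁ q₂ q₃ : ℝ} {p : ℝ → V}
    {P : ℝ → V →L[ℝ] V} (hP : PlateFamily B c q₁ q₂ q₃ p P) (K : ℕ) [Nontrivial V]
    {G : V × ℝ → ℝ≥0∞} (hG : Measurable G) :
    ∫⁻ x, ⨆ j : Fin (2 ^ K), gaussLAverage (p (dyadicPoint K j)) (P (dyadicPoint K j)) G x ^ 2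
      ≤ (K + 1) * ((1 + K * ENNReal.ofReal (CurveCoords.variationConst B c)) * ∫⁻ z, G z ^ 2) := by
  -- Truncation in height and in space increases to G, so monotone convergence carries over the
  -- bound for bounded functions with bounded support.
  set T : ℕ → V × ℝ → ℝ≥0∞ := fun n => {z : V × ℝ | ‖z.1‖ ≤ n}.indicator fun z => min (G z) n with hT
  have hset : ∀ n : ℕ, MeasurableSet {z : V × ℝ | ‖z.1‖ ≤ n} := fun n =>
    measurableSet_le measurable_fst.norm measurable_const
  have hTm : ∀ n, Measurable (T n) := fun n => (hG.min measurable_const).indicator (hset n)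
  have hTn : ∀ n z, T n z ≤ n := fun n z =>
    (indicator_le_self' (fun _ _ => zero_le) z).trans (min_le_right _ _)
  have hTG : ∀ n z, T n z ≤ G z := fun n z =>
    (indicator_le_self' (fun _ _ => zero_le) z).trans (min_le_left _ _)
  have hTmono : Monotone T := by
    intro n m hnm z
    have hnm' : (n : ℝ) ≤ m := by exact_mod_cast hnm
    by_cases hz : ‖z.1‖ ≤ n
    · simp only [hT]
      rw [indicator_of_mem (by exact hz), indicator_of_mem (by exact hz.trans hnm')]
      exact min_le_min_left _ (by exact_mod_cast hnm)
    · simp only [hT]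
      rw [indicator_of_notMem (by exact hz)]
      exact zero_le
  have hTsup : ∀ z, ⨆ n, T n z = G z := by
    intro z
    refine le_antisymm (iSup_le fun n => hTG n z) (le_of_forall_lt fun a ha => ?_)
    obtain ⟨N, hN⟩ := exists_nat_ge ‖z.1‖
    obtain ⟨M, hM⟩ := ENNReal.exists_nat_gt ha.ne_top
    refine lt_iSup_iff.2 ⟨max N M, ?_⟩
    have hz : ‖z.1‖ ≤ (max N M : ℕ) := hN.trans (by exact_mod_cast le_max_left _ _)
    simp only [hT]
    rw [indicator_of_mem (by exact hz)]
    exact lt_min ha (hM.trans_le (by exact_mod_cast le_max_right _ _))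
  have hAsup : ∀ (s : ℝ) x, gaussLAverage (p s) (P s) G x = ⨆ n, gaussLAverage (p s) (P s) (T n) x := by
    intro s x
    unfold gaussLAverage
    rw [← lintegral_iSup]
    · simp only [hTsup]
    · exact fun n => ((hTm n).comp (measurable_shift_left (p s) (P s))).comp measurable_prodMk_left
    · exact fun n m hnm τ => hTmono hnm _
  have hAmono : ∀ (s : ℝ) x, Monotone fun n => gaussLAverage (p s) (P s) (T n) x :=
    fun s x n m hnm => lintegral_mono fun τ => hTmono hnm _
  have hbs : ∀ n, BoundedSupp fun z => ((T n z).toReal : ℂ) := by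
    intro n
    refine ⟨Complex.measurable_ofReal.comp (hTm n).ennreal_toReal, ⟨n, fun z => ?_⟩,
      ⟨n, fun x t hx => ?_⟩⟩
    · rw [Complex.norm_real, Real.norm_of_nonneg ENNReal.toReal_nonneg]
      exact ENNReal.toReal_le_of_le_ofReal (Nat.cast_nonneg n) (by simpa using hTn n z)
    · have : T n (x, t) = 0 := indicator_of_notMem (by simpa using hx) _
      simp [this]
  simp only [hAsup, ENNReal.iSup_pow]
  have hswap : ∀ x, (⨆ j : Fin (2 ^ K), ⨆ n,
      gaussLAverage (p (dyadicPoint K j)) (P (dyadicPoint K j)) (T n) x ^ 2) = ⨆ n, ⨆ j : Fin (2 ^ K),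
      gaussLAverage (p (dyadicPoint K j)) (P (dyadicPoint K j)) (T n) x ^ 2 := fun x => iSup_comm
  simp only [hswap]
  rw [lintegral_iSup]
  · refine iSup_le fun n => ?_
    have h := (hbs n).lintegral_iSup_gaussAverage_le hP K
    simp only [enorm_gaussAverage_toReal _ _ (hTm n) (hTn n)] at h
    refine h.trans ?_
    gcongr with z
    rw [← ofReal_norm, Complex.norm_real, Real.norm_of_nonneg ENNReal.toReal_nonneg,
      ENNReal.ofReal_toReal ((hTn n z).trans_lt (ENNReal.natCast_lt_top n)).ne]
    exact hTG n z
  · exact fun n => .iSup fun j => (measurable_gaussLAverage _ _ (hTm n)).pow_const 2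
  · exact fun n m hnm x => iSup_mono fun j => pow_le_pow_left₀ (zero_le) (hAmono _ x hnm) 2

end MaximalEstimate

/-! ### Quantitative non-degeneracy of the curve. -/

namespace Nikodym
open Real

/-- The matrix with columns `γ'(s), γ''(s), γ'''(s)`. -/
noncomputable def derivMatrix (γ : ℝ → E3) (s : ℝ) : Matrix (Fin 3) (Fin 3) ℝ :=
  Matrix.of fun i j : Fin 3 => (iteratedDerivWithin ((j : ℕ) + 1) γ I s) i

/-- The basis dual to `γ'(s), γ''(s), γ'''(s)`. -/
noncomputable def dualFrame (γ : ℝ → E3) (s : ℝ) (i : Fin 3) : E3 :=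
  WithLp.toLp 2 ((derivMatrix γ s)⁻¹ i)

/-- Quantitative bounds for a non-degenerate curve. -/
structure FrameBounds (γ : ℝ → E3) (B D : ℝ) : Prop where
  B_pos : 0 < B
  D_pos : 0 < D
  smooth : ContDiffOn ℝ ∞ γ I
  norm_le : ∀ j ≤ 4, ∀ s ∈ I, ‖iteratedDerivWithin j γ I s‖ ≤ B
  dual_le : ∀ i, ∀ s ∈ I, ‖dualFrame γ s i‖ ≤ D
  det_ne : ∀ s ∈ I, (derivMatrix γ s).det ≠ 0
  det_le : ∀ s ∈ I, |(derivMatrix γ s).det| ≤ B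

theorem uniqueDiffOn_I : UniqueDiffOn ℝ I := uniqueDiffOn_Icc (by norm_num)

theorem continuousOn_iteratedDerivWithin {γ : ℝ → E3} (hγ : ContDiffOn ℝ ∞ γ I) (j : ℕ) :
    ContinuousOn (iteratedDerivWithin j γ I) I :=
  hγ.continuousOn_iteratedDerivWithin (by exact_mod_cast le_top) uniqueDiffOn_I

theorem hasDerivWithinAt_iteratedDerivWithin {γ : ℝ → E3} (hγ : ContDiffOn ℝ ∞ γ I) (j : ℕ)
    {s : ℝ} (hs : s ∈ I) :
    HasDerivWithinAt (iteratedDerivWithin j γ I) (iteratedDerivWithin (j + 1) γ I s) I s := by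
  rw [iteratedDerivWithin_succ]
  exact (hγ.differentiableOn_iteratedDerivWithin (by exact_mod_cast ENat.natCast_lt_top j)
    uniqueDiffOn_I s hs).hasDerivWithinAt

/-- Compactness of [-1, 1]: the inverse matrix is the adjugate divided by a determinant that never
vanishes, hence continuous. -/
theorem exists_frameBounds {γ : ℝ → E3} (hγ : ContDiffOn ℝ ∞ γ I) (hnd : NonDegenerate γ) :
    ∃ B D : ℝ, FrameBounds γ B D := by
  obtain ⟨c₀, hc₀, hdet⟩ := hnd
  have hdet0 : ∀ s ∈ I, (derivMatrix γ s).det ≠ 0 := fun s hs h => by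
    have := hdet s hs
    rw [show (Matrix.of fun i j : Fin 3 => (iteratedDerivWithin ((j : ℕ) + 1) γ I s) i)
      = derivMatrix γ s from rfl, h, abs_zero] at this
    linarith
  have hM : ContinuousOn (derivMatrix γ) I := by
    refine continuousOn_pi.2 fun i => continuousOn_pi.2 fun j => ?_
    exact (EuclideanSpace.proj (𝕜 := ℝ) i).continuous.comp_continuousOn
      (continuousOn_iteratedDerivWithin hγ ((j : ℕ) + 1))
  have hd : ContinuousOn (fun s => (derivMatrix γ s).det) I :=
    (continuous_id.matrix_det).comp_continuousOn hM
  have hdual : ∀ i, ContinuousOn (fun s => dualFrame γ s i) I := by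
    intro i
    refine (PiLp.continuous_toLp 2 _).comp_continuousOn (continuousOn_pi.2 fun j => ?_)
    have h1 : ContinuousOn (fun s => (derivMatrix γ s).adjugate i j) I :=
      ((continuous_id.matrix_adjugate).matrix_elem i j).comp_continuousOn hM
    refine ((hd.inv₀ hdet0).mul h1).congr fun s _ => ?_
    simp [Matrix.inv_def]
  have hcpt : IsCompact I := isCompact_Icc
  choose b hb using fun j => hcpt.exists_bound_of_continuousOn (continuousOn_iteratedDerivWithin hγ j)
  choose d hd' using fun i => hcpt.exists_bound_of_continuousOn (hdual i)
  obtain ⟨e, he⟩ := hcpt.exists_bound_of_continuousOn hd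
  refine ⟨1 + ∑ j ∈ Finset.range 5, |b j| + |e|, 1 + ∑ i, |d i|, ?_, ?_, hγ, ?_, ?_, hdet0, ?_⟩
  · positivity
  · positivity
  · intro j hj s hs
    have h1 := Finset.single_le_sum (f := fun j => |b j|) (s := Finset.range 5)
      (fun _ _ => abs_nonneg _) (Finset.mem_range.2 (by omega : j < 5))
    have h2 := hb j s hs
    have h3 := le_abs_self (b j)
    have h4 := abs_nonneg e
    linarith
  · intro i s hs
    have h1 := Finset.single_le_sum (f := fun i => |d i|) (s := Finset.univ)
      (fun _ _ => abs_nonneg _) (Finset.mem_univ i)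
    have h2 := hd' i s hs
    have h3 := le_abs_self (d i)
    linarith
  · intro s hs
    have h2 := he s hs
    rw [Real.norm_eq_abs] at h2
    have h3 := le_abs_self e
    have h4 : 0 ≤ ∑ j ∈ Finset.range 5, |b j| := Finset.sum_nonneg fun _ _ => abs_nonneg _
    linarith

/-- The linear map sending the coordinate axes to the axes of the smoothed plate. -/
noncomputable def plateMap (γ : ℝ → E3) (r : Fin 3 → ℝ) (s : ℝ) : E3 →L[ℝ] E3 :=
  LinearMap.toContinuousLinearMap
    (Matrix.toLpLin 2 2 (Matrix.of fun i j => r j * derivMatrix γ s i j))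

theorem plateMap_apply (γ : ℝ → E3) (r : Fin 3 → ℝ) (s : ℝ) (w : E3) :
    plateMap γ r s w = ∑ j : Fin 3, (r j * w j) • iteratedDerivWithin ((j : ℕ) + 1) γ I s := by
  ext i
  simp only [plateMap, LinearMap.coe_toContinuousLinearMap', Matrix.toLpLin_apply, Matrix.mulVec,
    dotProduct, Matrix.of_apply, derivMatrix, WithLp.ofLp_sum, Finset.sum_apply,
    PiLp.smul_apply, smul_eq_mul]
  exact Finset.sum_congr rfl fun j _ => by ring

theorem det_plateMap (γ : ℝ → E3) (r : Fin 3 → ℝ) (s : ℝ) :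
    LinearMap.det (plateMap γ r s : E3 →ₗ[ℝ] E3) = (∏ j, r j) * (derivMatrix γ s).det := by
  rw [plateMap, LinearMap.coe_toContinuousLinearMap, LinearMap.det_toLpLin, Matrix.det_mul_row]

theorem adjoint_plateMap_apply (γ : ℝ → E3) (r : Fin 3 → ℝ) (s : ℝ) (ξ : E3) (j : Fin 3) :
    (plateMap γ r s).adjoint ξ j = r j * inner ℝ (iteratedDerivWithin ((j : ℕ) + 1) γ I s) ξ := by
  have h : (plateMap γ r s).adjoint ξ j
      = inner ℝ (EuclideanSpace.single j (1 : ℝ)) ((plateMap γ r s).adjoint ξ) := by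
    rw [EuclideanSpace.inner_single_left, map_one, one_mul]
  rw [h, ContinuousLinearMap.adjoint_inner_right, plateMap_apply, sum_inner]
  simp only [inner_smul_left]
  rw [Finset.sum_eq_single j]
  · simp
  · intro i _ hij
    simp [hij]
  · simp

namespace FrameBounds

variable {γ : ℝ → E3} {B D : ℝ} (hb : FrameBounds γ B D)
include hb

theorem inner_dualFrame {s : ℝ} (hs : s ∈ I) (i j : Fin 3) :
    inner ℝ (dualFrame γ s i) (iteratedDerivWithin ((j : ℕ) + 1) γ I s) = if i = j then 1 else 0 := by
  have h := Matrix.nonsing_inv_mul (derivMatrix γ s) (isUnit_iff_ne_zero.2 (hb.det_ne s hs))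
  have h2 := congrFun (congrFun h i) j
  rw [Matrix.mul_apply, Matrix.one_apply] at h2
  rw [← h2, PiLp.inner_apply]
  simp [dualFrame, derivMatrix, mul_comm]

theorem sum_dualFrame {s : ℝ} (hs : s ∈ I) (u : E3) :
    ∑ i : Fin 3, inner ℝ (dualFrame γ s i) u • iteratedDerivWithin ((i : ℕ) + 1) γ I s = u := by
  have h := Matrix.mul_nonsing_inv (derivMatrix γ s) (isUnit_iff_ne_zero.2 (hb.det_ne s hs))
  have h2 : (derivMatrix γ s * (derivMatrix γ s)⁻¹).mulVec u = u := by rw [h, Matrix.one_mulVec]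
  ext k
  rw [← Matrix.mulVec_mulVec] at h2
  have h3 := congrFun h2 k
  rw [Matrix.mulVec, dotProduct] at h3
  rw [← h3]
  simp only [WithLp.ofLp_sum, Finset.sum_apply, PiLp.smul_apply, smul_eq_mul]
  refine Finset.sum_congr rfl fun i _ => ?_
  rw [mul_comm]
  congr 1
  simp [Matrix.mulVec, dotProduct, PiLp.inner_apply, dualFrame, mul_comm]

theorem norm_sub_le {j : ℕ} (hj : j ≤ 3) {s t : ℝ} (hs : s ∈ I) (ht : t ∈ I) :
    ‖iteratedDerivWithin j γ I t - iteratedDerivWithin j γ I s‖ ≤ B * |t - s| :=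
  Convex.norm_image_sub_le_of_norm_hasDerivWithin_le
    (fun _ hu => hasDerivWithinAt_iteratedDerivWithin hb.smooth j hu)
    (fun u hu => hb.norm_le (j + 1) (by omega) u hu) (convex_Icc _ _) hs ht

theorem curveCoords {ξ : E3} (hξ : ξ ≠ 0) :
    CurveCoords B (1 / (3 * D)) ‖ξ‖ fun j s => inner ℝ (iteratedDerivWithin j γ I s) ξ where
  B_pos := hb.B_pos
  c_pos := by have := hb.D_pos; positivity
  X_pos := norm_pos_iff.2 hξ
  deriv j _ s hs := by
    have := (hasDerivWithinAt_iteratedDerivWithin hb.smooth j hs).inner ℝ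
      (hasDerivWithinAt_const s I ξ)
    simpa using this
  cont j _ := (continuousOn_iteratedDerivWithin hb.smooth j).inner continuousOn_const
  bound j hj s hs := (abs_real_inner_le_norm _ _).trans
    (mul_le_mul_of_nonneg_right (hb.norm_le j hj s hs) (norm_nonneg _))
  lower s hs := by
    have hD := hb.D_pos
    have hX : 0 < ‖ξ‖ := norm_pos_iff.2 hξ
    -- Expansion of ξ in the derivative frame, with coefficients at most D‖ξ‖. Three pairings all
    -- below ‖ξ‖/(3D) could not add up to ‖ξ‖².
    have h1 : ‖ξ‖ ^ 2 = ∑ i : Fin 3, inner ℝ (dualFrame γ s i) ξ *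
        inner ℝ (iteratedDerivWithin ((i : ℕ) + 1) γ I s) ξ := by
      have e := congrArg (fun u => inner ℝ u ξ) (hb.sum_dualFrame hs ξ)
      rw [← real_inner_self_eq_norm_sq, ← e]
      simp [sum_inner, inner_smul_left]
    have h2 : ∀ i : Fin 3, inner ℝ (dualFrame γ s i) ξ *
        inner ℝ (iteratedDerivWithin ((i : ℕ) + 1) γ I s) ξ ≤
        D * ‖ξ‖ * |inner ℝ (iteratedDerivWithin ((i : ℕ) + 1) γ I s) ξ| := by
      intro i
      refine (le_abs_self _).trans ?_
      rw [abs_mul]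
      refine mul_le_mul_of_nonneg_right ((abs_real_inner_le_norm _ _).trans ?_) (abs_nonneg _)
      exact mul_le_mul_of_nonneg_right (hb.dual_le i s hs) hX.le
    have h3 := Finset.sum_le_sum fun i (_ : i ∈ Finset.univ) => h2 i
    rw [← h1, Fin.sum_univ_three] at h3
    simp only [Fin.isValue, Fin.val_zero, Fin.val_one, Fin.val_two, zero_add, Nat.reduceAdd] at h3
    by_contra hcon
    simp only [not_or, not_le] at hcon
    obtain ⟨c1, c2, c3⟩ := hcon
    have e : D * ‖ξ‖ * (1 / (3 * D) * ‖ξ‖) = ‖ξ‖ ^ 2 / 3 := by field_simp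
    have g : ∀ a : ℝ, a < 1 / (3 * D) * ‖ξ‖ → D * ‖ξ‖ * a < ‖ξ‖ ^ 2 / 3 := fun a ha =>
      e ▸ mul_lt_mul_of_pos_left ha (by positivity)
    have := g _ c1
    have := g _ c2
    have := g _ c3
    linarith

/-- The exponents come from π‖P*ξ‖² = ∑ π r_j² ⟨γ^(j), ξ⟩², and their ordering is that of the side
lengths. -/
theorem plateFamily {r : Fin 3 → ℝ} (hr : ∀ j, 0 < r j) (h21 : r 2 ≤ r 1) (h10 : r 1 ≤ r 0) :
    PlateFamily B (1 / (3 * D)) (π * r 0 ^ 2) (π * r 1 ^ 2) (π * r 2 ^ 2) γ (plateMap γ r) where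
  B_pos := hb.B_pos
  c_pos := by have := hb.D_pos; positivity
  q₃_pos := mul_pos pi_pos (pow_pos (hr 2) 2)
  q₃_le := mul_le_mul_of_nonneg_left (pow_le_pow_left₀ (hr 2).le h21 2) pi_pos.le
  q₂_le := mul_le_mul_of_nonneg_left (pow_le_pow_left₀ (hr 1).le h10 2) pi_pos.le
  coords ξ hξ := by
    refine ⟨_, hb.curveCoords hξ, fun s => by rw [iteratedDerivWithin_zero], fun s => ?_⟩
    rw [gaussWeight, EuclideanSpace.real_norm_sq_eq, Fin.sum_univ_three]
    simp only [adjoint_plateMap_apply, Fin.isValue, Fin.val_zero, Fin.val_one, Fin.val_two,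
      zero_add, Nat.reduceAdd]
    congr 1
    ring

end FrameBounds
end Nikodym

/-! ### Comparison of plates with ellipsoids. -/

namespace Nikodym
open Real

namespace FrameBounds

variable {γ : ℝ → E3} {B D : ℝ} (hb : FrameBounds γ B D)
include hb

theorem linearIndependent {s : ℝ} (hs : s ∈ I) :
    LinearIndependent ℝ fun j : Fin 3 => iteratedDerivWithin ((j : ℕ) + 1) γ I s := by
  rw [Fintype.linearIndependent_iff]
  intro g hg i
  have h := congrArg (fun u => inner ℝ (dualFrame γ s i) u) hg
  simp only [inner_sum, inner_smul_right, hb.inner_dualFrame hs, inner_zero_right] at h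
  simpa using h

theorem orthonormal_frenet {s : ℝ} (hs : s ∈ I) : Orthonormal ℝ (frenet γ s) :=
  InnerProductSpace.gramSchmidtNormed_orthonormal (hb.linearIndependent hs)

theorem exists_orthonormalBasis {s : ℝ} (hs : s ∈ I) :
    ∃ e : OrthonormalBasis (Fin 3) ℝ E3, ∀ j, e j = frenet γ s j := by
  have ho := hb.orthonormal_frenet hs
  refine ⟨OrthonormalBasis.mk ho ?_, fun j => by rw [OrthonormalBasis.coe_mk]⟩
  exact (ho.linearIndependent.span_eq_top_of_card_eq_finrank' (by simp)).ge

/-- Gram–Schmidt is triangular: the j-th frame vector lies in the span of the derivative vectors of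
index at most j, all annihilated by the i-th dual vector when j < i. -/
theorem inner_dualFrame_frenet {s : ℝ} (hs : s ∈ I) {i j : Fin 3} (hij : j < i) :
    inner ℝ (dualFrame γ s i) (frenet γ s j) = 0 := by
  have h1 : InnerProductSpace.gramSchmidt ℝ
      (fun j : Fin 3 => iteratedDerivWithin ((j : ℕ) + 1) γ I s) j ∈ Submodule.span ℝ
        ((fun j : Fin 3 => iteratedDerivWithin ((j : ℕ) + 1) γ I s) '' Iic j) :=
    InnerProductSpace.gramSchmidt_mem_span ℝ _ le_rfl
  have h2 : ∀ u ∈ Submodule.span ℝ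
      ((fun j : Fin 3 => iteratedDerivWithin ((j : ℕ) + 1) γ I s) '' Iic j),
      inner ℝ (dualFrame γ s i) u = 0 := by
    intro u hu
    induction hu using Submodule.span_induction with
    | mem x hx =>
      obtain ⟨k, hk, rfl⟩ := hx
      rw [hb.inner_dualFrame hs, if_neg ((lt_of_le_of_lt hk hij).ne')]
    | zero => simp
    | add x y _ _ hx hy => rw [inner_add_right, hx, hy, add_zero]
    | smul a x _ hx => rw [inner_smul_right, hx, mul_zero]
  rw [frenet, InnerProductSpace.gramSchmidtNormed, inner_smul_right, h2 _ h1, mul_zero]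

/-- Coordinates of a plate vector with respect to the derivative frame. -/
theorem abs_inner_dualFrame_le {r : Fin 3 → ℝ} (hr : Antitone r) {s : ℝ}
    (hs : s ∈ I) {z : E3} (hz : ∀ j, |inner ℝ z (frenet γ s j)| ≤ r j) (i : Fin 3) :
    |inner ℝ (dualFrame γ s i) z| ≤ 3 * D * r i := by
  obtain ⟨e, he⟩ := hb.exists_orthonormalBasis hs
  have hD := hb.D_pos
  have hri : 0 ≤ r i := (abs_nonneg _).trans (hz i)
  have h1 : inner ℝ (dualFrame γ s i) z
      = ∑ j, inner ℝ (dualFrame γ s i) (frenet γ s j) * inner ℝ z (frenet γ s j) := by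
    have := e.sum_inner_mul_inner (dualFrame γ s i) z
    rw [← this]
    refine Finset.sum_congr rfl fun j _ => ?_
    rw [he, real_inner_comm z]
  rw [h1]
  refine (Finset.abs_sum_le_sum_abs _ _).trans ?_
  have h2 : ∀ j : Fin 3, |inner ℝ (dualFrame γ s i) (frenet γ s j) * inner ℝ z (frenet γ s j)|
      ≤ D * r i := by
    intro j
    -- Terms with j < i vanish by triangularity, and for j ≥ i the side r_j is at most r_i.
    rcases lt_or_ge j i with hij | hij
    · rw [hb.inner_dualFrame_frenet hs hij, zero_mul, abs_zero]
      positivity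
    · rw [abs_mul]
      refine mul_le_mul ?_ ((hz j).trans (hr hij)) (abs_nonneg _) hD.le
      refine (abs_real_inner_le_norm _ _).trans ?_
      rw [(hb.orthonormal_frenet hs).1 j, mul_one]
      exact hb.dual_le i s hs
  calc _ ≤ ∑ _j : Fin 3, D * r i := Finset.sum_le_sum fun j _ => h2 j
    _ = 3 * D * r i := by simp; ring

/-- A plate is contained in the ellipsoid attached to a nearby parameter. -/
theorem exists_plateMap_eq {r : Fin 3 → ℝ} (hr0 : ∀ j, r j ∈ Ioo (0 : ℝ) 1) (hr : Antitone r)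
    {s σ : ℝ} (hs : s ∈ I) (hσ : σ ∈ I) (hsσ : |s - σ| ≤ r 2) {y : E3} {t : ℝ}
    (hy : (y, t) ∈ plate γ r s) :
    ∃ w : E3, ‖w‖ ≤ 2 * (3 * D + D * ((9 * D + 2) * B)) ∧ y = t • γ σ + plateMap γ r σ w := by
  have hB := hb.B_pos
  have hD := hb.D_pos
  obtain ⟨⟨ht1, ht2⟩, hz⟩ := hy
  simp only at ht1 ht2 hz
  set z := y - t • γ s with hzdef
  set α : Fin 3 → ℝ := fun i => inner ℝ (dualFrame γ s i) z with hα
  have hαle : ∀ i, |α i| ≤ 3 * D := fun i =>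
    (hb.abs_inner_dualFrame_le hr hs hz i).trans
      (mul_le_of_le_one_right (by positivity) (hr0 i).2.le)
  -- The cost of replacing s by σ in the frame and in the centre. It is O(r₃), hence admissible in
  -- every coordinate because r₃ is the smallest side.
  set err : E3 := (∑ k : Fin 3, α k • (iteratedDerivWithin ((k : ℕ) + 1) γ I s -
    iteratedDerivWithin ((k : ℕ) + 1) γ I σ)) + t • (γ s - γ σ) with herr
  have herrle : ‖err‖ ≤ (9 * D + 2) * B * r 2 := by
    have h1 : ∀ k : Fin 3, ‖α k • (iteratedDerivWithin ((k : ℕ) + 1) γ I s -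
        iteratedDerivWithin ((k : ℕ) + 1) γ I σ)‖ ≤ 3 * D * (B * r 2) := by
      intro k
      rw [norm_smul, Real.norm_eq_abs]
      refine mul_le_mul (hαle k) ((hb.norm_sub_le (by omega) hσ hs).trans ?_) (norm_nonneg _)
        (by positivity)
      exact mul_le_mul_of_nonneg_left hsσ hB.le
    have h2 : ‖t • (γ s - γ σ)‖ ≤ 2 * (B * r 2) := by
      rw [norm_smul, Real.norm_of_nonneg (by linarith)]
      have h3 := hb.norm_sub_le (j := 0) (by omega) hσ hs
      rw [iteratedDerivWithin_zero] at h3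
      exact mul_le_mul ht2 (h3.trans (mul_le_mul_of_nonneg_left hsσ hB.le)) (norm_nonneg _)
        (by norm_num)
    calc ‖err‖ ≤ (∑ _k : Fin 3, 3 * D * (B * r 2)) + 2 * (B * r 2) :=
          (norm_add_le _ _).trans (add_le_add ((norm_sum_le _ _).trans
            (Finset.sum_le_sum fun k _ => h1 k)) h2)
      _ = (9 * D + 2) * B * r 2 := by simp; ring
  have hsplit : y - t • γ σ =
      (∑ k : Fin 3, α k • iteratedDerivWithin ((k : ℕ) + 1) γ I σ) + err := by
    have h := hb.sum_dualFrame hs z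
    have h' : ∑ k : Fin 3, α k • iteratedDerivWithin ((k : ℕ) + 1) γ I s = y - t • γ s := h
    rw [herr]
    simp only [smul_sub, Finset.sum_sub_distrib]
    rw [h']
    abel
  set β : Fin 3 → ℝ := fun i => inner ℝ (dualFrame γ σ i) (y - t • γ σ) with hβ
  have hβle : ∀ i, |β i| ≤ (3 * D + D * ((9 * D + 2) * B)) * r i := by
    intro i
    have h1 : β i = α i + inner ℝ (dualFrame γ σ i) err := by
      simp only [hβ, hsplit, inner_add_right, inner_sum, inner_smul_right,
        hb.inner_dualFrame hσ]
      simp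
    have h2 : |inner ℝ (dualFrame γ σ i) err| ≤ D * ((9 * D + 2) * B * r i) := by
      refine (abs_real_inner_le_norm _ _).trans ?_
      refine mul_le_mul (hb.dual_le i σ hσ) (herrle.trans ?_) (norm_nonneg _) hD.le
      exact mul_le_mul_of_nonneg_left (hr (Fin.le_last i)) (by positivity)
    rw [h1]
    refine (abs_add_le _ _).trans ((add_le_add (hb.abs_inner_dualFrame_le hr hs hz i) h2).trans ?_)
    exact le_of_eq (by ring)
  set R := 3 * D + D * ((9 * D + 2) * B) with hR
  have hR0 : 0 ≤ R := by positivity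
  -- Each of the three rescaled coordinates is at most R, and √3 ≤ 2 gives the bound 2R.
  refine ⟨WithLp.toLp 2 fun i => β i / r i, ?_, ?_⟩
  · refine (sq_le_sq₀ (norm_nonneg _) (by positivity)).1 ?_
    rw [EuclideanSpace.real_norm_sq_eq]
    have h1 : ∀ i : Fin 3, (β i / r i) ^ 2 ≤ R ^ 2 := by
      intro i
      refine sq_le_sq' ?_ ?_
      · rw [le_div_iff₀ (hr0 i).1]
        have := neg_le_of_abs_le (hβle i)
        linarith
      · rw [div_le_iff₀ (hr0 i).1]
        exact le_of_abs_le (hβle i)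
    have h2 := Finset.sum_le_sum fun i (_ : i ∈ Finset.univ) => h1 i
    simp only [Finset.sum_const, Finset.card_univ, Fintype.card_fin, nsmul_eq_mul] at h2
    push_cast at h2
    nlinarith [sq_nonneg R]
  · rw [plateMap_apply, ← sub_eq_iff_eq_add']
    conv_lhs => rw [← hb.sum_dualFrame hσ (y - t • γ σ)]
    refine Finset.sum_congr rfl fun i _ => ?_
    simp only
    rw [mul_div_cancel₀ _ (hr0 i).1.ne']

end FrameBounds

theorem measurableSet_plate (γ : ℝ → E3) (r : Fin 3 → ℝ) (s : ℝ) : MeasurableSet (plate γ r s) := by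
  have h : plate γ r s = Prod.snd ⁻¹' Icc (1 : ℝ) 2 ∩
      ⋂ j, {p : E3 × ℝ | |inner ℝ (p.1 - p.2 • γ s) (frenet γ s j)| ≤ r j} := by
    ext p
    simp [plate]
  rw [h]
  refine (measurable_snd measurableSet_Icc).inter (MeasurableSet.iInter fun j => ?_)
  exact measurableSet_le (Continuous.measurable (by fun_prop)) measurable_const

/-- Each slice with t in [1, 2] is a translated box with sides 2 r_j in an orthonormal basis, and
the time interval has length one. -/
theorem FrameBounds.volume_plate {γ : ℝ → E3} {B D : ℝ} (hb : FrameBounds γ B D) {r : Fin 3 → ℝ}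
    (hr0 : ∀ j, 0 ≤ r j) {s : ℝ} (hs : s ∈ I) :
    volume (plate γ r s) = ENNReal.ofReal (8 * ∏ j, r j) := by
  obtain ⟨e, he⟩ := hb.exists_orthonormalBasis hs
  set S : Set E3 := {z | ∀ j, |inner ℝ z (frenet γ s j)| ≤ r j} with hS
  have hSvol : volume S = ENNReal.ofReal (8 * ∏ j, r j) := by
    have h1 : S = e.repr ⁻¹' (WithLp.ofLp ⁻¹' (Set.pi univ fun j => Icc (-r j) (r j))) := by
      ext z
      simp only [hS, mem_ofPred_eq, mem_preimage, mem_pi, mem_univ, true_imp_iff, mem_Icc, ← abs_le,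
        OrthonormalBasis.repr_apply_apply, he]
      exact forall_congr' fun j => by rw [real_inner_comm]
    have hm : MeasurableSet (Set.pi univ fun j : Fin 3 => Icc (-r j) (r j)) :=
      MeasurableSet.univ_pi fun j => measurableSet_Icc
    rw [h1, e.measurePreserving_repr.measure_preimage
      ((PiLp.volume_preserving_ofLp (Fin 3)).measurable hm).nullMeasurableSet,
      (PiLp.volume_preserving_ofLp (Fin 3)).measure_preimage hm.nullMeasurableSet,
      volume_pi_pi]
    simp only [Real.volume_Icc]
    rw [← ENNReal.ofReal_prod_of_nonneg fun j _ => by have := hr0 j; linarith]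
    congr 1
    simp only [Fin.prod_univ_three]
    ring
  have hslice : ∀ t : ℝ, volume ((fun y : E3 => (y, t)) ⁻¹' plate γ r s)
      = (Icc (1 : ℝ) 2).indicator (fun _ => ENNReal.ofReal (8 * ∏ j, r j)) t := by
    intro t
    by_cases ht : t ∈ Icc (1 : ℝ) 2
    · rw [indicator_of_mem ht, ← hSvol]
      have : (fun y : E3 => (y, t)) ⁻¹' plate γ r s = (fun y => y - t • γ s) ⁻¹' S := by
        ext y
        simp only [mem_preimage, plate, mem_ofPred_eq, hS]
        exact and_iff_right ht
      simp only [this, sub_eq_add_neg]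
      rw [measure_preimage_add_right]
    · rw [indicator_of_notMem ht]
      have : (fun y : E3 => (y, t)) ⁻¹' plate γ r s = ∅ := by
        ext y
        simp only [mem_preimage, plate, mem_ofPred_eq, mem_empty_iff_false, iff_false]
        exact fun h => ht h.1
      rw [this, measure_empty]
  rw [Measure.volume_eq_prod, Measure.prod_apply_symm (measurableSet_plate γ r s)]
  simp only [hslice]
  rw [lintegral_indicator measurableSet_Icc, setLIntegral_const, Real.volume_Icc]
  norm_num

/-- At fixed t, the substitution y = tγ(σ) + Pw has Jacobian at most B ∏ r_j and sends the plate
into the ball ‖w‖ ≤ R, where the Gaussian density is at least exp(-πR²). -/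
theorem FrameBounds.lintegral_plate_le {γ : ℝ → E3} {B D : ℝ} (hb : FrameBounds γ B D)
    {r : Fin 3 → ℝ} (hr0 : ∀ j, r j ∈ Ioo (0 : ℝ) 1) (hr : Antitone r) {s σ : ℝ} (hs : s ∈ I)
    (hσ : σ ∈ I) (hsσ : |s - σ| ≤ r 2) {G : E3 × ℝ → ℝ≥0∞} (hG : Measurable G) (x : E3) :
    ∫⁻ p in plate γ r s, G (x - p.1, p.2) ≤
      ENNReal.ofReal ((∏ j, r j) * B * exp (π * (2 * (3 * D + D * ((9 * D + 2) * B))) ^ 2)) *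
        gaussLAverage (γ σ) (plateMap γ r σ) G x := by
  set R := 2 * (3 * D + D * ((9 * D + 2) * B)) with hR
  set P := plateMap γ r σ with hP
  have hprod : 0 < ∏ j, r j := Finset.prod_pos fun j _ => (hr0 j).1
  have hdet : LinearMap.det (P : E3 →ₗ[ℝ] E3) ≠ 0 := by
    rw [hP, det_plateMap]
    exact mul_ne_zero hprod.ne' (hb.det_ne σ hσ)
  have hdetle : |LinearMap.det (P : E3 →ₗ[ℝ] E3)| ≤ (∏ j, r j) * B := by
    rw [hP, det_plateMap, abs_mul, abs_of_pos hprod]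
    exact mul_le_mul_of_nonneg_left (hb.det_le σ hσ) hprod.le
  have hcov : ∀ h : E3 → ℝ≥0∞, Measurable h → ∫⁻ z, h z =
      ENNReal.ofReal |LinearMap.det (P : E3 →ₗ[ℝ] E3)| * ∫⁻ w, h (P w) := by
    intro h hh
    have h1 := Measure.map_linearMap_addHaar_eq_smul_addHaar (volume : Measure E3) hdet
    have h2 : ∫⁻ w, h (P w) = ENNReal.ofReal |(LinearMap.det (P : E3 →ₗ[ℝ] E3))⁻¹| * ∫⁻ z, h z := by
      rw [← smul_eq_mul, ← lintegral_smul_measure, ← h1, lintegral_map hh]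
      · rfl
      · exact P.continuous.measurable
    rw [h2, ← mul_assoc, ← ENNReal.ofReal_mul (abs_nonneg _), ← abs_mul, mul_inv_cancel₀ hdet]
    simp
  have hslice : ∀ t ∈ Icc (1 : ℝ) 2, ∫⁻ y, (plate γ r s).indicator (fun p => G (x - p.1, p.2)) (y, t)
      ≤ ENNReal.ofReal ((∏ j, r j) * B * exp (π * R ^ 2)) *
        ∫⁻ w, G (x - plateShift (γ σ) P (t, w), t) ∂gaussMeasure E3 := by
    intro t ht
    have hm : Measurable fun y : E3 => (plate γ r s).indicator (fun p => G (x - p.1, p.2)) (y, t) := by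
      have h1 : Measurable ((plate γ r s).indicator fun p : E3 × ℝ => G (x - p.1, p.2)) :=
        (hG.comp ((measurable_const.sub measurable_fst).prodMk measurable_snd)).indicator
          (measurableSet_plate γ r s)
      exact h1.comp measurable_prodMk_right
    have hm2 : Measurable fun w : E3 => G (x - plateShift (γ σ) P (t, w), t) :=
      hG.comp ((measurable_const.sub (((continuous_plateShift (γ σ) P).measurable).comp
        measurable_prodMk_left)).prodMk measurable_const)
    rw [← lintegral_add_left_eq_self _ (t • γ σ),
      hcov (fun z => (plate γ r s).indicator (fun p => G (x - p.1, p.2)) (t • γ σ + z, t))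
        (hm.comp (measurable_const_add _)),
      gaussMeasure, lintegral_withDensity_eq_lintegral_mul _ (by fun_prop) hm2,
      ENNReal.ofReal_mul (by have := hb.B_pos; positivity), mul_assoc,
      ← lintegral_const_mul' (ENNReal.ofReal (exp (π * R ^ 2))) _ ENNReal.ofReal_ne_top]
    refine mul_le_mul' (ENNReal.ofReal_le_ofReal hdetle) (lintegral_mono fun w => ?_)
    simp only [Pi.mul_apply]
    by_cases hw : (t • γ σ + P w, t) ∈ plate γ r s
    · rw [indicator_of_mem hw]
      obtain ⟨w', hw', hyw⟩ := hb.exists_plateMap_eq hr0 hr hs hσ hsσ hw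
      have hww : w' = w := by
        have h3 : (P : E3 →ₗ[ℝ] E3) w = (P : E3 →ₗ[ℝ] E3) w' := add_left_cancel hyw
        have h4 : Function.Injective (P : E3 →ₗ[ℝ] E3) :=
          (LinearMap.equivOfDetNeZero (P : E3 →ₗ[ℝ] E3) hdet).injective
        exact (h4 h3).symm
      rw [hww] at hw'
      rw [← mul_assoc, ← ENNReal.ofReal_mul (exp_pos _).le, ← exp_add]
      have h5 : (1 : ℝ≥0∞) ≤ ENNReal.ofReal (exp (π * R ^ 2 + -π * ‖w‖ ^ 2)) := by
        rw [ENNReal.one_le_ofReal, one_le_exp_iff]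
        have := pow_le_pow_left₀ (norm_nonneg w) hw' 2
        nlinarith [pi_pos]
      calc _ = 1 * G (x - plateShift (γ σ) P (t, w), t) := by rw [one_mul]; rfl
        _ ≤ _ := mul_le_mul_left h5 _
    · rw [indicator_of_notMem hw]
      exact zero_le
  have hmeas : Measurable ((plate γ r s).indicator fun p : E3 × ℝ => G (x - p.1, p.2)) :=
    (hG.comp ((measurable_const.sub measurable_fst).prodMk measurable_snd)).indicator
      (measurableSet_plate γ r s)
  rw [← lintegral_indicator (measurableSet_plate γ r s), Measure.volume_eq_prod,
    lintegral_prod_symm _ hmeas.aemeasurable, gaussLAverage, slabGauss, lintegral_prod,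
    ← lintegral_const_mul' _ _ ENNReal.ofReal_ne_top, ← lintegral_indicator measurableSet_Icc]
  · refine lintegral_mono fun t => ?_
    by_cases ht : t ∈ Icc (1 : ℝ) 2
    · rw [indicator_of_mem ht]
      exact hslice t ht
    · rw [indicator_of_notMem ht]
      refine le_of_eq ((lintegral_congr fun y => ?_).trans lintegral_zero)
      exact indicator_of_notMem (fun h => ht h.1) _
  · exact ((hG.comp (measurable_shift_left (γ σ) P)).comp measurable_prodMk_left).aemeasurable

end Nikodym

/-- Averaging an `L²` function over translates of a set of finite measure is continuous. -/
theorem continuous_setIntegral_sub {V : Type*} [NormedAddCommGroup V] [InnerProductSpace ℝ V]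
    [FiniteDimensional ℝ V] [MeasurableSpace V] [BorelSpace V] {g : V × ℝ → ℂ}
    (hg : MemLp g 2 volume) {S : Set (V × ℝ)} (hS : MeasurableSet S) (hS' : volume S ≠ ⊤) :
    Continuous fun x : V => ∫ p in S, g (x - p.1, p.2) := by
  set T : V → C(V × ℝ, V × ℝ) := fun x => ⟨fun p => (x - p.1, p.2), by fun_prop⟩ with hT
  have hTc : Continuous T := by
    refine ContinuousMap.continuous_of_continuous_uncurry _ ?_
    simp only [hT, Function.uncurry_def, ContinuousMap.coe_mk]
    fun_prop
  have hTm : ∀ x, MeasurePreserving (T x) volume volume := fun x =>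
    (Measure.measurePreserving_sub_left (volume : Measure V) x).prod (MeasurePreserving.id volume)
  have hc : Continuous fun x => Lp.compMeasurePreserving (T x) (hTm x) (hg.toLp g) :=
    continuous_const.compMeasurePreservingLp hTc hTm (by norm_num)
  -- The integral is the L² pairing of a fixed indicator with a measure-preserving rearrangement of
  -- g, which depends continuously on x in L².
  have hi : Continuous fun x => inner ℂ (indicatorConstLp 2 hS hS' (1 : ℂ))
      (Lp.compMeasurePreserving (T x) (hTm x) (hg.toLp g)) := continuous_const.inner hc
  refine hi.congr fun x => ?_
  rw [L2.inner_indicatorConstLp_one]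
  refine integral_congr_ae (ae_restrict_of_ae ?_)
  filter_upwards [Lp.coeFn_compMeasurePreserving (hg.toLp g) (hTm x),
    (hTm x).quasiMeasurePreserving.ae_eq_comp hg.coeFn_toLp] with p h1 h2
  rw [h1, h2]
  rfl

/-! ### Measurability and discretization of the maximal function. -/

namespace Nikodym
open Real

/-- The supremum is uncountable, but each average is continuous in x, so the supremum is lower
semicontinuous. -/
theorem measurable_nikodymSing {γ : ℝ → E3} {B D : ℝ} (hb : FrameBounds γ B D) {r : Fin 3 → ℝ}
    (hr0 : ∀ j, 0 ≤ r j) {g : E3 × ℝ → ℂ} (hg : MemLp g 2 volume) :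
    Measurable (nikodymSing γ r g) := by
  refine LowerSemicontinuous.measurable (lowerSemicontinuous_biSup fun s hs => ?_)
  refine Continuous.lowerSemicontinuous ?_
  simp only [plateAverage, setAverage_eq]
  exact ((continuous_setIntegral_sub hg (measurableSet_plate γ r s)
    (by rw [hb.volume_plate hr0 hs]; exact ENNReal.ofReal_ne_top)).const_smul _).enorm

/-- The constant in the comparison of plate averages with smoothed averages. -/
noncomputable def comparisonConst (B D : ℝ) : ℝ :=
  B * exp (π * (2 * (3 * D + D * ((9 * D + 2) * B))) ^ 2)

/-- The plate volume 8 ∏ r_j cancels the product in the Jacobian, which makes the constant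
independent of r; the gain of 1/8 is discarded. -/
theorem enorm_plateAverage_le {γ : ℝ → E3} {B D : ℝ} (hb : FrameBounds γ B D)
    {r : Fin 3 → ℝ} (hr0 : ∀ j, r j ∈ Ioo (0 : ℝ) 1) (hr : Antitone r) {s σ : ℝ} (hs : s ∈ I)
    (hσ : σ ∈ I) (hsσ : |s - σ| ≤ r 2) {g : E3 × ℝ → ℂ} {G : E3 × ℝ → ℝ≥0∞} (hG : Measurable G)
    (hgG : ∀ᵐ z, ‖g z‖ₑ = G z) (x : E3) :
    ‖plateAverage γ r g x s‖ₑ ≤ ENNReal.ofReal (comparisonConst B D) *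
        gaussLAverage (γ σ) (plateMap γ r σ) G x := by
  have hprod : 0 < ∏ j, r j := Finset.prod_pos fun j _ => (hr0 j).1
  have hB := hb.B_pos
  have hTm : MeasurePreserving (fun p : E3 × ℝ => (x - p.1, p.2)) volume volume :=
    (Measure.measurePreserving_sub_left (volume : Measure E3) x).prod (MeasurePreserving.id volume)
  have hae : ∀ᵐ p : E3 × ℝ, ‖g (x - p.1, p.2)‖ₑ = G (x - p.1, p.2) :=
    hTm.quasiMeasurePreserving.ae hgG
  rw [plateAverage, setAverage_eq, enorm_smul, measureReal_def, hb.volume_plate (fun j => (hr0 j).1.le) hs,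
    ENNReal.toReal_ofReal (by positivity), Real.enorm_of_nonneg (by positivity)]
  have h1 : ‖∫ p in plate γ r s, g (x - p.1, p.2)‖ₑ ≤ ∫⁻ p in plate γ r s, G (x - p.1, p.2) :=
    (enorm_integral_le_lintegral_enorm _).trans (le_of_eq (lintegral_congr_ae
      (ae_restrict_of_ae hae)))
  refine (mul_le_mul' le_rfl (h1.trans (hb.lintegral_plate_le hr0 hr hs hσ hsσ hG x))).trans ?_
  rw [← mul_assoc, ← ENNReal.ofReal_mul (by positivity)]
  refine mul_le_mul' (ENNReal.ofReal_le_ofReal ?_) le_rfl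
  rw [mul_assoc (∏ j, r j), ← comparisonConst, ← mul_assoc]
  refine mul_le_of_le_one_left (by unfold comparisonConst; positivity) ?_
  rw [mul_inv, mul_assoc, inv_mul_cancel₀ hprod.ne']
  norm_num

/-- Every parameter is close to a point of the dyadic grid. -/
theorem exists_dyadicPoint_near (K : ℕ) {s : ℝ} (hs : s ∈ I) :
    ∃ j : Fin (2 ^ K), |s - dyadicPoint K j| ≤ 2 / 2 ^ K := by
  have h2 : (0 : ℝ) < 2 ^ K := by positivity
  have h2n : 0 < 2 ^ K := by positivity
  rcases lt_or_ge s 1 with h | h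
  · have hu0 : 0 ≤ (s + 1) / 2 * 2 ^ K := mul_nonneg (by linarith [hs.1]) h2.le
    have hlt : ⌊(s + 1) / 2 * 2 ^ K⌋₊ < 2 ^ K := by
      rw [Nat.floor_lt hu0]
      push_cast
      nlinarith
    refine ⟨⟨_, hlt⟩, ?_⟩
    have f1 := Nat.floor_le hu0
    have f2 := Nat.lt_floor_add_one ((s + 1) / 2 * 2 ^ K)
    simp only [dyadicPoint]
    set n : ℝ := (⌊(s + 1) / 2 * 2 ^ K⌋₊ : ℝ)
    have e : s - (-1 + 2 * n / 2 ^ K) = ((s + 1) / 2 * 2 ^ K - n) * (2 / 2 ^ K) := by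
      field_simp; ring
    rw [e, abs_of_nonneg (mul_nonneg (by linarith) (by positivity))]
    exact mul_le_of_le_one_left (by positivity) (by linarith)
  -- The point 1 would have index 2^K, outside `Fin (2 ^ K)`; the last admissible point is exactly
  -- one step 2 / 2^K away.
  · have hs1 : s = 1 := le_antisymm hs.2 h
    refine ⟨⟨2 ^ K - 1, by omega⟩, le_of_eq ?_⟩
    have e : s - dyadicPoint K (2 ^ K - 1) = 2 / 2 ^ K := by
      rw [hs1, dyadicPoint, Nat.cast_sub h2n]
      push_cast
      field_simp
      ring
    simp only [e]
    exact abs_of_nonneg (by positivity)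

theorem nikodymSing_sq_le {γ : ℝ → E3} {B D : ℝ} (hb : FrameBounds γ B D)
    {r : Fin 3 → ℝ} (hr0 : ∀ j, r j ∈ Ioo (0 : ℝ) 1) (hr : Antitone r) {K : ℕ}
    (hK : 2 / 2 ^ K ≤ r 2) {g : E3 × ℝ → ℂ} {G : E3 × ℝ → ℝ≥0∞} (hG : Measurable G)
    (hgG : ∀ᵐ z, ‖g z‖ₑ = G z) (x : E3) :
    nikodymSing γ r g x ^ 2 ≤ ENNReal.ofReal (comparisonConst B D) ^ 2 * ⨆ j : Fin (2 ^ K),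
      gaussLAverage (γ (dyadicPoint K j)) (plateMap γ r (dyadicPoint K j)) G x ^ 2 := by
  have : Nonempty (Fin (2 ^ K)) := ⟨⟨0, by positivity⟩⟩
  rw [← ENNReal.iSup_pow, ← mul_pow]
  refine pow_le_pow_left₀ zero_le (iSup₂_le fun s hs => ?_) 2
  obtain ⟨j, hj⟩ := exists_dyadicPoint_near K hs
  refine (enorm_plateAverage_le hb hr0 hr hs (dyadicPoint_mem K j.2.le) (hj.trans hK) hG hgG x).trans ?_
  exact mul_le_mul' le_rfl (le_iSup (fun j : Fin (2 ^ K) =>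
    gaussLAverage (γ (dyadicPoint K j)) (plateMap γ r (dyadicPoint K j)) G x) j)

theorem exists_generation {ρ : ℝ} (h0 : 0 < ρ) (h1 : ρ < 1) :
    ∃ K : ℕ, 2 / 2 ^ K ≤ ρ ∧ (K : ℝ) + 1 ≤ 4 * (1 + |log ρ|) := by
  have hlog : 0 ≤ -log ρ := neg_nonneg.2 (log_nonpos h0.le h1.le)
  have hl2 := log_two_gt_d9
  have hl2' : 0 < log 2 := by linarith
  -- The condition is K log 2 ≥ log 2 + |log ρ|, and this choice meets it because 2 log 2 ≥ 1.
  refine ⟨⌈1 + 2 * (-log ρ)⌉₊, ?_, ?_⟩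
  · have hK := Nat.le_ceil (1 + 2 * (-log ρ))
    set K := ⌈1 + 2 * (-log ρ)⌉₊
    rw [div_le_iff₀ (by positivity), ← div_le_iff₀' h0,
      ← log_le_log_iff (by positivity) (by positivity), log_pow, log_div (by norm_num) h0.ne']
    have := mul_le_mul_of_nonneg_right hK hl2'.le
    nlinarith
  · have hK := (Nat.ceil_lt_add_one (by linarith : 0 ≤ 1 + 2 * (-log ρ))).le
    rw [abs_of_nonpos (by linarith)]
    linarith

end Nikodym

/-! ### The maximal theorem. -/

open Nikodym

theorem mainTheorem5 (γ : ℝ → Nikodym.E3) (hγ : ContDiffOn ℝ ∞ γ (Icc (-1) 1))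
    (hnd : Nikodym.NonDegenerate γ) :
    ∃ C : ℝ, 0 < C ∧ ∀ r : Fin 3 → ℝ, (∀ j, r j ∈ Ioo (0 : ℝ) 1) →
      r 2 ≤ r 1 → r 1 ≤ r 0 → r 0 ≤ (r 1) ^ (1 / 2 : ℝ) →
      r 1 ≤ (r 0) ^ (1 / 2 : ℝ) * (r 2) ^ (1 / 2 : ℝ) →
      ∀ g : Nikodym.E3 × ℝ → ℂ, MemLp g 2 volume →
        Measurable (Nikodym.nikodymSing γ r g) ∧
        eLpNorm (Nikodym.nikodymSing γ r g) 2 volume ≤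
          ENNReal.ofReal (C * (1 + |Real.log (r 2)|) ^ 3) * eLpNorm g 2 volume := by
  obtain ⟨B, D, hb⟩ := exists_frameBounds hγ hnd
  set v := CurveCoords.variationConst B (1 / (3 * D)) with hv
  have hv0 : 0 ≤ v := variationConst_nonneg
  set c := comparisonConst B D with hc
  have hc0 : 0 < c := mul_pos hb.B_pos (Real.exp_pos _)
  refine ⟨4 * c * (1 + v), by positivity, fun r hr0 h21 h10 _ _ g hg => ?_⟩
  have hr : Antitone r := Fin.antitone_iff_succ_le.2 fun i => by fin_cases i <;> assumption
  refine ⟨measurable_nikodymSing hb (fun j => (hr0 j).1.le) hg, ?_⟩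
  obtain ⟨K, hK, hKlog⟩ := exists_generation (hr0 2).1 (hr0 2).2
  set L := 1 + |Real.log (r 2)| with hL
  have hL1 : 1 ≤ L := le_add_of_nonneg_right (abs_nonneg _)
  -- The maximal estimate for non-negative functions needs a measurable integrand, so g is replaced
  -- by a measurable representative.
  set g' := hg.1.mk g with hg'
  have hgg' : ∀ᵐ z, ‖g z‖ₑ = ‖g' z‖ₑ := by
    filter_upwards [hg.1.ae_eq_mk] with z hz
    rw [hz]
  have hG : Measurable fun z => ‖g' z‖ₑ := hg.1.stronglyMeasurable_mk.measurable.enorm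
  have hmax := lintegral_iSup_gaussLAverage_le
    (hb.plateFamily (fun j => (hr0 j).1) h21 h10) K hG
  have hgint : ∫⁻ z, ‖g' z‖ₑ ^ 2 = eLpNorm g 2 volume ^ 2 := by
    rw [eLpNorm_two_sq]
    refine lintegral_congr_ae ?_
    filter_upwards [hgg'] with z hz
    rw [hz]
  rw [hgint] at hmax
  refine (ENNReal.pow_le_pow_left_iff two_ne_zero).1 ?_
  rw [eLpNorm_two_sq, mul_pow]
  simp only [enorm_eq_self]
  calc ∫⁻ x, nikodymSing γ r g x ^ 2
      ≤ ∫⁻ x, ENNReal.ofReal c ^ 2 * ⨆ j : Fin (2 ^ K),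
        gaussLAverage (γ (dyadicPoint K j)) (plateMap γ r (dyadicPoint K j))
          (fun z => ‖g' z‖ₑ) x ^ 2 :=
        lintegral_mono fun x => nikodymSing_sq_le hb hr0 hr hK hG hgg' x
    _ ≤ ENNReal.ofReal c ^ 2 * ((K + 1) * ((1 + K * ENNReal.ofReal v) *
        eLpNorm g 2 volume ^ 2)) := by
        rw [lintegral_const_mul' _ _ (ENNReal.pow_ne_top ENNReal.ofReal_ne_top)]
        exact mul_le_mul' le_rfl hmax
    _ = ENNReal.ofReal (c ^ 2 * ((K + 1) * (1 + K * v))) * eLpNorm g 2 volume ^ 2 := by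
        rw [ENNReal.ofReal_mul (by positivity), ENNReal.ofReal_pow hc0.le,
          ENNReal.ofReal_mul (by positivity), ENNReal.ofReal_add (by positivity) zero_le_one,
          ENNReal.ofReal_add zero_le_one (by positivity), ENNReal.ofReal_mul (by positivity),
          ENNReal.ofReal_natCast, ENNReal.ofReal_one]
        ring
    _ ≤ ENNReal.ofReal (4 * c * (1 + v) * L ^ 3) ^ 2 * eLpNorm g 2 volume ^ 2 := by
        rw [← ENNReal.ofReal_pow (by positivity)]
        refine mul_le_mul' (ENNReal.ofReal_le_ofReal ?_) le_rfl
        have hK0 : (0 : ℝ) ≤ K := Nat.cast_nonneg K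
        have s1 : 1 + K * v ≤ (K + 1) * (1 + v) := by nlinarith
        have s2 : ((K : ℝ) + 1) * (1 + K * v) ≤ (4 * L) ^ 2 * (1 + v) := by
          calc ((K : ℝ) + 1) * (1 + K * v) ≤ (K + 1) * ((K + 1) * (1 + v)) := by gcongr
            _ = (K + 1) ^ 2 * (1 + v) := by ring
            _ ≤ (4 * L) ^ 2 * (1 + v) := by gcongr
        -- The chaining bound for the squared norm is of order L²; L ≥ 1 relaxes it to the square of
        -- L³.
        have s3 : (4 * L) ^ 2 * (1 + v) ≤ (4 * L ^ 3) ^ 2 * (1 + v) ^ 2 := by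
          have : L ≤ L ^ 3 := le_self_pow₀ hL1 (by norm_num)
          have : 1 + v ≤ (1 + v) ^ 2 := le_self_pow₀ (by linarith) (by norm_num)
          gcongr
        calc c ^ 2 * ((K + 1) * (1 + K * v)) ≤ c ^ 2 * ((4 * L ^ 3) ^ 2 * (1 + v) ^ 2) := by
              exact mul_le_mul_of_nonneg_left (s2.trans s3) (by positivity)
          _ = _ := by ring
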